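/- Let $K$ be a field that is complete for an ultrametric norm $|\cdot|$, with infinite residue field and non-discrete value group $|K^*|$ (for instance $K$ complete, algebraically closed and non-trivially normed). Let $\mathbb P^1(K)=K\sqcup\{\infty\}$. *Balls.* For $a\in K$ and $r>0$ put $D^-(a,r)=\{z\in K: |z-a|<r\}$ and $D(a,r)=\{z\in K:|z-a|\le r\}$. If $r\in|K^*|$, these are an open and a closed ball of $K$; if $r\notin|K^*|$, they coincide and form an irrational ball of $K$. An open (resp. closed, irrational) ball of $\mathbb P^1(K)$ is such a ball of $K$, or the complement in $\mathbb P^1(K)$ of a closed (resp. open, irrational) ball of $K$. An open affinoid is a finite (possibly empty) intersection of open balls of $\mathbb P^1(K)$. *Berkovich line and weak topology.* Give $\mathbb P^1(K)$ the uniform structure whose entourages are the sets containing $\bigcup_{Y\in C}Y\times Y$ for some finite covering $C$ of $\mathbb P^1(K)$ by open affinoids. Let $\mathsf P^1_K$ (the Berkovich projective line) be its separated completion, i.e. the uniform space of minimal Cauchy filters; its topology is called the weak topology. A point of $\mathbb P^1(K)$ is identified with its filter of neighbourhoods. For $Y\subset\mathbb P^1(K)$ let $\widehat Y=\{\mathcal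 F\in\mathsf P^1_K: Y\in\mathcal F\}$, and let $\overline Y$ be the closure of $Y$ in $\mathsf P^1_K$. The open balls of $\mathsf P^1_K$ are the sets $\widehat B$ with $B$ an open or irrational ball of $\mathbb P^1(K)$; its closed balls are the sets $\overline B$ with $B$ a closed or irrational ball of $\mathbb P^1(K)$. For $\mathcal F\in\mathsf P^1_K$ let $B_{\mathcal F}$ be the intersection of all balls of $K$ that belong to $\mathcal F$. The point of $\mathsf P^1_K$ determined by a ball $B$ of $\mathbb P^1(K)$ (and by the corresponding ball $\widehat B$ or $\overline B$ of $\mathsf P^1_K$) is the unique $\mathcal F$ for which $B_{\mathcal F}$ is the closed or irrational ball of $K$ that contains $E$ and has the same diameter as $E$, where $E$ is whichever of $B$ and $\mathbb P^1(K)\setminus B$ is contained in $K$. *Fine topology.* Let $\mathsf A_K^{\mathbb R}$ be the quotient of $K\times[0,\infty)$ by the relation $(x,r)\sim(x',r')\iff r=r'\ge|x-x'|$, with the distance $\delta([x,r],[x',r'])=\max\{r,r',|x-x'|\}-\tfrac12(r+r')$, and let $\mathsf A_K$ be its completion. The function $\operatorname{diam}[x,r]=r$ extends continuously to $\mathsf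 A_K$; put $\sup\{S,S'\}=\delta(S,S')+\tfrac12(\operatorname{diam}S+\operatorname{diam}S')$, $|S|=\sup\{S,[0,0]\}$ and $m(S)=\max\{1,|S|\}$. Give $\mathsf A_K\sqcup\{\infty\}$ the distance $$\Delta(S,S')=\frac{\sup\{S,S'\}}{m(S)\,m(S')}-\frac{\operatorname{diam}S}{2\,m(S)^2}-\frac{\operatorname{diam}S'}{2\,m(S')^2},\qquad \Delta(S,\infty)=\frac1{m(S)}-\frac{\operatorname{diam}S}{2\,m(S)^2}.$$ There is a unique map $\iota:\mathsf A_K\sqcup\{\infty\}\to\mathsf P^1_K$ that is continuous for $\Delta$ and the weak topology and satisfies $B_{\iota([x,r])}=D(x,r)$ for all $x\in K$, $r>0$; it is bijective. The fine topology of $\mathsf P^1_K$ is the topology of $(\mathsf A_K\sqcup\{\infty\},\Delta)$ transported by $\iota$. **Corollary.** Every (open or closed) ball of $\mathsf P^1_K$ is connected for the weak topology and for the fine topology. The boundary of a ball of $\mathsf P^1_K$, for the fine topology as well as for the weak topology, consists of exactly one point, namely the point of $\mathsf P^1_K$ determined by this ball. -/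

import Mathlib

open Filter Topology Set
open scoped NNReal

namespace BerkovichLine

/-! ## Balls of `K` and of the projective line -/

section Balls

set_option linter.unusedSectionVars false

variable (K : Type*) [NormedField K]

/-- The value group `|K^*|`, as a set of positive real numbers. -/
def valueGroup : Set ℝ := {r | ∃ z : K, z ≠ 0 ∧ ‖z‖ = r}

/-- The projective line of `K`, as the set `K ⊔ {∞}` (see `OnePoint.equivProjectivization` for the
bijection with the set of lines of `K²`).  The topology that Mathlib puts on `OnePoint K` plays no
role below. -/
abbrev P1 : Type _ := OnePoint K

variable {K}

/-- Open balls of `K`: `{|z - a| < r}` with `r ∈ |K^*|`. -/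
def IsOpenBallK (D : Set K) : Prop := ∃ a : K, ∃ r ∈ valueGroup K, D = {z | ‖z - a‖ < r}

/-- Closed balls of `K`: `{|z - a| ≤ r}` with `r ∈ |K^*|`. -/
def IsClosedBallK (D : Set K) : Prop := ∃ a : K, ∃ r ∈ valueGroup K, D = {z | ‖z - a‖ ≤ r}

/-- Irrational balls of `K`: `{|z - a| < r}` (which is also `{|z - a| ≤ r}`) with `r > 0` not in
`|K^*|`. -/
def IsIrrationalBallK (D : Set K) : Prop :=
  ∃ a : K, ∃ r : ℝ, 0 < r ∧ r ∉ valueGroup K ∧ D = {z | ‖z - a‖ < r}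

/-- Balls of `K`, of any nature. -/
def IsBallK (D : Set K) : Prop := IsOpenBallK D ∨ IsClosedBallK D ∨ IsIrrationalBallK D

/-- A subset of `K`, seen in the projective line. -/
def toP1 (D : Set K) : Set (P1 K) := (fun z : K => (z : OnePoint K)) '' D

/-- Open balls of the projective line: open balls of `K` and complements of closed balls of `K`. -/
def IsOpenBall (B : Set (P1 K)) : Prop :=
  ∃ D : Set K, (IsOpenBallK D ∧ B = toP1 D) ∨ (IsClosedBallK D ∧ B = (toP1 D)ᶜ)

/-- Closed balls of the projective line: closed balls of `K` and complements of open balls of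
`K`. -/
def IsClosedBall (B : Set (P1 K)) : Prop :=
  ∃ D : Set K, (IsClosedBallK D ∧ B = toP1 D) ∨ (IsOpenBallK D ∧ B = (toP1 D)ᶜ)

/-- Irrational balls of the projective line: irrational balls of `K` and their complements. -/
def IsIrrationalBall (B : Set (P1 K)) : Prop :=
  ∃ D : Set K, IsIrrationalBallK D ∧ (B = toP1 D ∨ B = (toP1 D)ᶜ)

/-- Open affinoids: finite (possibly empty) intersections of open balls. -/
def IsOpenAffinoid (Y : Set (P1 K)) : Prop :=
  ∃ S : Set (Set (P1 K)), S.Finite ∧ (∀ B ∈ S, IsOpenBall B) ∧ Y = ⋂₀ S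

/-- Finite coverings of the projective line by open affinoids. -/
def IsAffinoidCover (C : Set (Set (P1 K))) : Prop :=
  C.Finite ∧ (∀ Y ∈ C, IsOpenAffinoid Y) ∧ ⋃₀ C = univ

/-- `V(C)`, the union of the squares `Y × Y` over the members `Y` of `C`. -/
def coverEntourage (C : Set (Set (P1 K))) : Set (P1 K × P1 K) := ⋃ Y ∈ C, Y ×ˢ Y

theorem IsOpenAffinoid.inter {Y Z : Set (P1 K)} (hY : IsOpenAffinoid Y) (hZ : IsOpenAffinoid Z) :
    IsOpenAffinoid (Y ∩ Z) := by
  obtain ⟨S, hS, hSb, rfl⟩ := hY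
  obtain ⟨T, hT, hTb, rfl⟩ := hZ
  refine ⟨S ∪ T, hS.union hT, ?_, (sInter_union S T).symm⟩
  rintro B (hB | hB)
  exacts [hSb B hB, hTb B hB]

theorem isOpenAffinoid_univ : IsOpenAffinoid (univ : Set (P1 K)) :=
  ⟨∅, finite_empty, by simp, by simp⟩

theorem IsAffinoidCover.inter {C C' : Set (Set (P1 K))} (h : IsAffinoidCover C)
    (h' : IsAffinoidCover C') : IsAffinoidCover (image2 (· ∩ ·) C C') := by
  refine ⟨h.1.image2 _ h'.1, ?_, ?_⟩
  · rintro _ ⟨Y, hY, Z, hZ, rfl⟩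
    exact (h.2.1 Y hY).inter (h'.2.1 Z hZ)
  · refine eq_univ_of_forall fun x => ?_
    obtain ⟨Y, hY, hxY⟩ : x ∈ ⋃₀ C := h.2.2 ▸ mem_univ x
    obtain ⟨Z, hZ, hxZ⟩ : x ∈ ⋃₀ C' := h'.2.2 ▸ mem_univ x
    exact ⟨Y ∩ Z, ⟨Y, hY, Z, hZ, rfl⟩, hxY, hxZ⟩

theorem coverEntourage_inter (C C' : Set (Set (P1 K))) :
    coverEntourage (image2 (· ∩ ·) C C') ⊆ coverEntourage C ∩ coverEntourage C' := by
  intro p hp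
  simp only [coverEntourage, mem_iUnion] at hp
  obtain ⟨_, ⟨Y, hY, Z, hZ, rfl⟩, h1, h2⟩ := hp
  simp only [coverEntourage, mem_inter_iff, mem_iUnion]
  exact ⟨⟨Y, hY, h1.1, h2.1⟩, ⟨Z, hZ, h1.2, h2.2⟩⟩

variable (K)

/-- The filter of entourages of the uniform structure on the projective line: the sets that
contain `V(C)` for some finite covering `C` by open affinoids. -/
def entourages : Filter (P1 K × P1 K) where
  sets := {V | ∃ C, IsAffinoidCover C ∧ coverEntourage C ⊆ V}
  univ_sets := ⟨{univ}, ⟨finite_singleton _, by simp [isOpenAffinoid_univ], by simp⟩,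
    subset_univ _⟩
  sets_of_superset := fun ⟨C, hC, h⟩ hVW => ⟨C, hC, h.trans hVW⟩
  inter_sets := fun ⟨C, hC, h⟩ ⟨C', hC', h'⟩ =>
    ⟨_, hC.inter hC', (coverEntourage_inter C C').trans (inter_subset_inter h h')⟩

end Balls

/-! ## The Berkovich projective line with its weak topology -/

section Berkovich

variable (K : Type*) [NormedField K]

variable {K} in
/-- Cauchy filters for the uniform structure `entourages K`. -/
def IsCauchyFilter (F : Filter (P1 K)) : Prop :=
  F.NeBot ∧ ∀ V ∈ entourages K, ∃ A ∈ F, A ×ˢ A ⊆ V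

/-- The Berkovich projective line, i.e. the separated completion of the projective line: the set
of minimal Cauchy filters.  In Mathlib `F ≤ G` means that `G` is coarser than `F`, i.e. every
member of `G` is a member of `F`. -/
def Ber : Type _ :=
  {F : Filter (P1 K) // IsCauchyFilter F ∧ ∀ G, IsCauchyFilter G → F ≤ G → G = F}

variable {K}

/-- The set of pairs of minimal Cauchy filters having a common `V`-small member. -/
def hatEntourage (V : Set (P1 K × P1 K)) : Set (Ber K × Ber K) :=
  {p | ∃ A : Set (P1 K), A ∈ p.1.1 ∧ A ∈ p.2.1 ∧ A ×ˢ A ⊆ V}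

theorem hatEntourage_mono {V W : Set (P1 K × P1 K)} (h : V ⊆ W) :
    hatEntourage V ⊆ hatEntourage W :=
  fun _ ⟨A, h1, h2, h3⟩ => ⟨A, h1, h2, h3.trans h⟩

variable (K) in
/-- The weak topology: the topology of the uniform structure on `Ber K` generated by the sets
`hatEntourage V`. -/
@[reducible] def weakTopology : TopologicalSpace (Ber K) where
  IsOpen U := ∀ F ∈ U, ∃ V ∈ entourages K, ∀ G, (F, G) ∈ hatEntourage V → G ∈ U
  isOpen_univ := fun _ _ => ⟨univ, univ_mem, fun _ _ => mem_univ _⟩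
  isOpen_inter := fun _ _ hU hU' F hF => by
    obtain ⟨V, hV, h⟩ := hU F hF.1
    obtain ⟨V', hV', h'⟩ := hU' F hF.2
    exact ⟨V ∩ V', inter_mem hV hV', fun G hG =>
      ⟨h G (hatEntourage_mono inter_subset_left hG),
        h' G (hatEntourage_mono inter_subset_right hG)⟩⟩
  isOpen_sUnion := fun S hS F ⟨U, hU, hF⟩ => by
    obtain ⟨V, hV, h⟩ := hS U hU F hF
    exact ⟨V, hV, fun G hG => ⟨U, hU, h G hG⟩⟩

/-- The point of `Ber K` that is identified with the point `x` of the projective line is the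
filter of neighbourhoods `V(x)` of `x` for the uniform structure. -/
def IsClassicalPoint (F : Ber K) (x : P1 K) : Prop :=
  ∀ A : Set (P1 K), A ∈ F.1 ↔ ∃ V ∈ entourages K, {y | (x, y) ∈ V} ⊆ A

/-- A subset of the projective line, seen as a subset of `Ber K`. -/
def classicalImage (Y : Set (P1 K)) : Set (Ber K) := {F | ∃ x ∈ Y, IsClassicalPoint F x}

/-- The set `Ŷ` of the points of `Ber K`, as filters, that contain `Y`. -/
def hat (Y : Set (P1 K)) : Set (Ber K) := {F | Y ∈ F.1}

/-- The closure of `Y` in `Ber K` for the weak topology. -/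
def bar (Y : Set (P1 K)) : Set (Ber K) := @closure _ (weakTopology K) (classicalImage Y)

/-- `𝔅` is the open ball, or the closed ball, of `Ber K` that is given by the ball `B` of the
projective line.  An irrational ball `B` gives both an open and a closed ball. -/
def IsBerBall (B : Set (P1 K)) (𝔅 : Set (Ber K)) : Prop :=
  ((IsOpenBall B ∨ IsIrrationalBall B) ∧ 𝔅 = hat B) ∨
    ((IsClosedBall B ∨ IsIrrationalBall B) ∧ 𝔅 = bar B)

/-- `B_F`, the intersection of all the balls of `K` that belong to the filter `F`. -/
def core (F : Ber K) : Set (P1 K) := ⋂₀ {A | A ∈ F.1 ∧ ∃ D : Set K, IsBallK D ∧ A = toP1 D}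

/-- `F` is the point of `Ber K` determined by the ball `B` of the projective line: if `E` is the
one of `B` and its complement that is contained in `K`, then `B_F` is the closed or irrational
ball of `K` that contains `E` and has the same diameter as `E`. -/
def IsPointOfBall (F : Ber K) (B : Set (P1 K)) : Prop :=
  ∃ D E : Set K, (B = toP1 E ∨ B = (toP1 E)ᶜ) ∧ (IsClosedBallK D ∨ IsIrrationalBallK D) ∧
    E ⊆ D ∧ Metric.diam D = Metric.diam E ∧ core F = toP1 D

end Berkovich

/-! ## The tree of `K` -/

section Tree

/-- Pairs `(x, r)` with `x ∈ K` and `r ∈ [0, +∞)`. -/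
structure PreArb (K : Type*) where
  center : K
  radius : ℝ≥0

variable (K : Type*) [NormedField K] [IsUltrametricDist K]

variable {K} in
theorem delta_aux {x y z : K} {r s t : ℝ} :
    max (max r t) (dist x z) + s ≤ max (max r s) (dist x y) + max (max s t) (dist y z) := by
  have h := dist_triangle_max x y z
  have a1 := le_max_left r s
  have a2 := le_max_right r s
  have a3 := le_max_left (max r s) (dist x y)
  have a4 := le_max_right (max r s) (dist x y)
  have b1 := le_max_left s t
  have b2 := le_max_right s t
  have b3 := le_max_left (max s t) (dist y z)
  have b4 := le_max_right (max s t) (dist y z)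
  rcases le_max_iff.1 h with h | h
  · rw [← le_sub_iff_add_le]
    refine max_le (max_le ?_ ?_) ?_ <;> linarith
  · rw [← le_sub_iff_add_le]
    refine max_le (max_le ?_ ?_) ?_ <;> linarith

/-- The function `δ((x, r), (x', r')) = max {r, r', |x - x'|} - (r + r') / 2`. -/
noncomputable instance : PseudoMetricSpace (PreArb K) where
  dist p q := max (max (p.radius : ℝ) q.radius) (dist p.center q.center) -
    (p.radius + q.radius) / 2
  dist_self p := by simp
  dist_comm p q := by rw [max_comm (p.radius : ℝ), dist_comm, add_comm]
  dist_triangle p q s := by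
    have := delta_aux (x := p.center) (y := q.center) (z := s.center) (r := p.radius)
      (s := q.radius) (t := s.radius)
    linarith

variable {K} in
theorem PreArb.dist_def (p q : PreArb K) :
    dist p q = max (max (p.radius : ℝ) q.radius) (dist p.center q.center) -
      (p.radius + q.radius) / 2 := rfl

/-- The space of balls: the quotient of `K × [0, +∞)` by the relation
`(x, r) ∼ (x', r') ↔ r = r' ∧ |x - x'| ≤ r`, which is the relation `δ = 0` (see
`ArbR.mk_eq_mk_iff`), with the distance `δ`. -/
abbrev ArbR : Type _ := SeparationQuotient (PreArb K)

variable {K} in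
/-- The point `[x, r]` of the space of balls. -/
noncomputable def ArbR.mk (x : K) (r : ℝ≥0) : ArbR K := SeparationQuotient.mk ⟨x, r⟩

variable {K} in
theorem ArbR.mk_eq_mk_iff {x y : K} {r s : ℝ≥0} :
    ArbR.mk x r = ArbR.mk y s ↔ r = s ∧ dist x y ≤ r := by
  rw [ArbR.mk, ArbR.mk, SeparationQuotient.mk_eq_mk, Metric.inseparable_iff, PreArb.dist_def]
  dsimp only
  constructor
  · intro h
    have a1 := le_max_left (r : ℝ) s
    have a2 := le_max_right (r : ℝ) s
    have a3 := le_max_left (max (r : ℝ) s) (dist x y)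
    have a4 := le_max_right (max (r : ℝ) s) (dist x y)
    have : (r : ℝ) = s := by linarith
    exact ⟨NNReal.coe_injective this, by linarith⟩
  · rintro ⟨rfl, h⟩
    simp [h]

/-- The tree of `K`: the completion of the space of balls for `δ`. -/
abbrev Arb : Type _ := UniformSpace.Completion (ArbR K)

variable {K}

/-- The point `[x, r]` of the tree of `K`. -/
noncomputable def pt (x : K) (r : ℝ≥0) : Arb K := (ArbR.mk x r : UniformSpace.Completion (ArbR K))

theorem dist_pt (x y : K) (r s : ℝ≥0) :
    dist (pt x r) (pt y s) = max (max (r : ℝ) s) (dist x y) - (r + s) / 2 :=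
  UniformSpace.Completion.dist_eq _ _

theorem PreArb.lipschitz_radius : LipschitzWith 2 (fun p : PreArb K => (p.radius : ℝ)) := by
  refine LipschitzWith.of_dist_le_mul fun p q => ?_
  rw [Real.dist_eq, PreArb.dist_def, NNReal.coe_ofNat]
  have a1 := le_max_left (p.radius : ℝ) q.radius
  have a2 := le_max_right (p.radius : ℝ) q.radius
  have a3 := le_max_left (max (p.radius : ℝ) q.radius) (dist p.center q.center)
  rw [abs_le]
  constructor <;> linarith

/-- The function `diam` on the space of balls, `diam [x, r] = r`. -/
noncomputable def ArbR.diam : ArbR K → ℝ :=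
  SeparationQuotient.lift (fun p : PreArb K => (p.radius : ℝ))
    fun _ _ h => (h.map PreArb.lipschitz_radius.continuous).eq

/-- The function `diam` on the tree, extended from the space of balls by continuity. -/
noncomputable def diam : Arb K → ℝ := UniformSpace.Completion.extension ArbR.diam

theorem ArbR.uniformContinuous_diam : UniformContinuous (ArbR.diam (K := K)) := by
  rw [ArbR.diam, SeparationQuotient.uniformContinuous_lift]
  exact PreArb.lipschitz_radius.uniformContinuous

theorem continuous_diam : Continuous (diam (K := K)) := UniformSpace.Completion.continuous_extension

theorem diam_pt (x : K) (r : ℝ≥0) : diam (pt x r) = r :=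
  UniformSpace.Completion.extension_coe ArbR.uniformContinuous_diam _

/-- The function `sup {S, S'}`, which is determined by
`δ(S, S') = sup {S, S'} - (diam S + diam S') / 2`. -/
noncomputable def supr (S T : Arb K) : ℝ := dist S T + (diam S + diam T) / 2

theorem supr_pt (x y : K) (r s : ℝ≥0) :
    supr (pt x r) (pt y s) = max (max (r : ℝ) s) (dist x y) := by
  rw [supr, dist_pt, diam_pt, diam_pt]; ring

/-- The function `|S| = sup {S, 0}`, which extends `|[x, r]| = max {|x|, r}` (see `abv_pt`). -/
noncomputable def abv (S : Arb K) : ℝ := supr S (pt 0 0)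

theorem abv_pt (x : K) (r : ℝ≥0) : abv (pt x r) = max ‖x‖ r := by
  rw [abv, supr_pt, dist_zero_right, NNReal.coe_zero, max_eq_left r.coe_nonneg, max_comm]

theorem denseRange_pt : DenseRange (fun p : PreArb K => pt p.center p.radius) :=
  UniformSpace.Completion.denseRange_coe.comp
    SeparationQuotient.surjective_mk.denseRange (UniformSpace.Completion.continuous_coe _)

theorem continuous_supr : Continuous (fun p : Arb K × Arb K => supr p.1 p.2) :=
  continuous_dist.add
    (((continuous_diam.comp continuous_fst).add (continuous_diam.comp continuous_snd)).div_const 2)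

theorem diam_nonneg (S : Arb K) : 0 ≤ diam S :=
  isClosed_property denseRange_pt (isClosed_le continuous_const continuous_diam)
    (fun p => by rw [diam_pt]; exact p.radius.coe_nonneg) S

theorem supr_self (S : Arb K) : supr S S = diam S := by rw [supr, dist_self]; ring

theorem supr_comm (S T : Arb K) : supr S T = supr T S := by
  rw [supr, supr, dist_comm, add_comm (diam S)]

theorem supr_le_max (S T U : Arb K) : supr S U ≤ max (supr S T) (supr T U) := by
  have hc : ∀ {f g : Arb K × Arb K × Arb K → Arb K}, Continuous f → Continuous g →
      Continuous fun p => supr (f p) (g p) := fun hf hg => continuous_supr.comp (hf.prodMk hg)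
  refine isClosed_property3 denseRange_pt (p := fun S T U => supr S U ≤ max (supr S T) (supr T U))
    (isClosed_le (hc (by fun_prop) (by fun_prop))
      ((hc (by fun_prop) (by fun_prop)).max (hc (by fun_prop) (by fun_prop)))) (fun p q s => ?_)
    S T U
  simp only [supr_pt]
  have h := dist_triangle_max p.center q.center s.center
  grind

theorem diam_le_supr (S T : Arb K) : diam S ≤ supr S T := by
  have := supr_le_max S T S
  rwa [supr_self, supr_comm T S, max_self] at this

theorem diam_le_abv (S : Arb K) : diam S ≤ abv S := diam_le_supr _ _

theorem abv_nonneg (S : Arb K) : 0 ≤ abv S := (diam_nonneg S).trans (diam_le_abv S)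

theorem abv_le_max (S T : Arb K) : abv S ≤ max (supr S T) (abv T) := supr_le_max _ _ _

theorem supr_le_max_abv (S T : Arb K) : supr S T ≤ max (abv S) (abv T) := by
  have := supr_le_max S (pt 0 0) T
  rwa [supr_comm (pt 0 0) T] at this

end Tree

/-! ## The projective tree of `K` with the chordal distance -/

section ProjectiveTree

/-- The projective tree of `K`: the disjoint union of the tree of `K` and of a point `∞`. -/
inductive ArbP (K : Type*) [NormedField K] [IsUltrametricDist K]
  | of (S : Arb K) : ArbP K
  | infty : ArbP K

variable {K : Type*} [NormedField K] [IsUltrametricDist K]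

/-- The chordal distance on the projective tree.  Its values at the pairs that contain `∞` are the
limits for `|S'| → ∞` of the values on the tree; its restriction to `K ⊔ {∞}` is the usual chordal
distance `|x - y| / (max {1, |x|} max {1, |y|})`, `1 / max {1, |x|}`. -/
noncomputable def chordal : ArbP K → ArbP K → ℝ
  | .of S, .of T => supr S T / (max 1 (abv S) * max 1 (abv T)) -
      diam S / max 1 (abv S) ^ 2 / 2 - diam T / max 1 (abv T) ^ 2 / 2
  | .of S, .infty => 1 / max 1 (abv S) - diam S / max 1 (abv S) ^ 2 / 2
  | .infty, .of T => 1 / max 1 (abv T) - diam T / max 1 (abv T) ^ 2 / 2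
  | .infty, .infty => 0

/-- Auxiliary: the function `s` for which `chordal P Q = s P Q - s P P / 2 - s Q Q / 2`. -/
noncomputable def chordalSup : ArbP K → ArbP K → ℝ
  | .of S, .of T => supr S T / (max 1 (abv S) * max 1 (abv T))
  | .of S, .infty => 1 / max 1 (abv S)
  | .infty, .of T => 1 / max 1 (abv T)
  | .infty, .infty => 0

theorem chordal_eq (P Q : ArbP K) :
    chordal P Q = chordalSup P Q - chordalSup P P / 2 - chordalSup Q Q / 2 := by
  rcases P with S | _ <;> rcases Q with T | _ <;>
    simp [chordal, chordalSup, supr_self, sq]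

theorem chordalSup_comm (P Q : ArbP K) : chordalSup P Q = chordalSup Q P := by
  rcases P with S | _ <;> rcases Q with T | _ <;> simp only [chordalSup]
  rw [supr_comm, mul_comm]

theorem chordal_aux {a b c x y z : ℝ} (ha : 0 < a) (hb : 0 < b) (hc : 0 < c) (hx : 0 ≤ x)
    (hy : 0 ≤ y) (h1 : z ≤ max x y) (h2 : z ≤ max a c) (h3 : b ≤ max a x)
    (h4 : b ≤ max c y) : z / (a * c) ≤ max (x / (a * b)) (y / (b * c)) := by
  have main : z * b ≤ x * c ∨ z * b ≤ y * a := by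
    have p1 : ∀ {u v : ℝ}, z ≤ u → b ≤ v → 0 ≤ u → z * b ≤ u * v := fun h h' hu =>
      mul_le_mul h h' hb.le hu
    have p2 : ∀ {u v : ℝ}, z ≤ v → b ≤ u → 0 ≤ v → z * b ≤ u * v := fun h h' hu => by
      have := p1 h h' hu
      linarith
    rcases le_max_iff.1 h1 with hzx | hzy
    · by_cases hbc : b ≤ c
      · exact .inl (p1 hzx hbc hx)
      · have hby : b ≤ y := (le_max_iff.1 h4).resolve_left hbc
        rcases le_max_iff.1 h2 with hza | hzc
        · exact .inr (p2 hza hby ha.le)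
        · rcases le_max_iff.1 h3 with hba | hbx
          · exact .inr (p2 (hzc.trans ((le_of_not_ge hbc).trans hba)) hby ha.le)
          · exact .inl (p2 hzc hbx hc.le)
    · by_cases hba : b ≤ a
      · exact .inr (p1 hzy hba hy)
      · have hbx : b ≤ x := (le_max_iff.1 h3).resolve_left hba
        rcases le_max_iff.1 h2 with hza | hzc
        · rcases le_max_iff.1 h4 with hbc | hby
          · exact .inl (p2 (hza.trans ((le_of_not_ge hba).trans hbc)) hbx hc.le)
          · exact .inr (p2 hza hby ha.le)
        · exact .inl (p2 hzc hbx hc.le)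
  rcases main with h | h
  · refine le_max_of_le_left ?_
    rw [div_le_div_iff₀ (by positivity) (by positivity)]
    linarith [mul_le_mul_of_nonneg_left h ha.le]
  · refine le_max_of_le_right ?_
    rw [div_le_div_iff₀ (by positivity) (by positivity)]
    linarith [mul_le_mul_of_nonneg_left h hc.le]

theorem chordalSup_le_max (P Q R : ArbP K) :
    chordalSup P R ≤ max (chordalSup P Q) (chordalSup Q R) := by
  have hM : ∀ S : Arb K, 0 < max 1 (abv S) := fun S => lt_max_of_lt_left one_pos
  have hs : ∀ S T : Arb K, 0 ≤ supr S T := fun S T => (diam_nonneg S).trans (diam_le_supr S T)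
  have hm : ∀ S T : Arb K, max 1 (abv S) ≤ max (max 1 (abv T)) (supr S T) := by
    intro S T
    have := abv_le_max S T
    grind
  have hsm : ∀ S T : Arb K, supr S T ≤ max (max 1 (abv S)) (max 1 (abv T)) := by
    intro S T
    have := supr_le_max_abv S T
    grind
  have hi : ∀ S : Arb K, 0 ≤ 1 / max 1 (abv S) := fun S => (one_div_pos.2 (hM S)).le
  have two : ∀ S T : Arb K, 1 / max 1 (abv S) ≤
      max (supr S T / (max 1 (abv S) * max 1 (abv T))) (1 / max 1 (abv T)) := by
    intro S T
    rcases le_max_iff.1 (hm T S) with h | h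
    · exact le_max_of_le_right (one_div_le_one_div_of_le (hM T) h)
    · refine le_max_of_le_left ?_
      rw [div_le_div_iff₀ (hM S) (mul_pos (hM S) (hM T)), supr_comm]
      linarith [mul_le_mul_of_nonneg_left h (hM S).le]
  rcases P with S | _ <;> rcases Q with T | _ <;> rcases R with U | _ <;> simp only [chordalSup]
  · refine chordal_aux (hM S) (hM T) (hM U) (hs _ _) (hs _ _) (supr_le_max _ _ _)
      (hsm _ _) ?_ (hm _ _)
    rw [supr_comm]
    exact hm _ _
  · exact two S T
  · rcases le_max_iff.1 (hsm S U) with h | h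
    · refine le_max_of_le_right ?_
      rw [div_le_div_iff₀ (mul_pos (hM S) (hM U)) (hM U)]
      linarith [mul_le_mul_of_nonneg_right h (hM U).le]
    · refine le_max_of_le_left ?_
      rw [div_le_div_iff₀ (mul_pos (hM S) (hM U)) (hM S)]
      linarith [mul_le_mul_of_nonneg_right h (hM S).le]
  · exact le_max_left _ _
  · have := two U T
    rwa [max_comm (supr U T / _), supr_comm U, mul_comm (max 1 (abv U))] at this
  · exact le_max_of_le_left (hi T)
  · exact le_max_right _ _
  · exact le_max_left _ _

theorem chordalSup_self_le (P Q : ArbP K) : chordalSup P P ≤ chordalSup P Q := by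
  have := chordalSup_le_max P Q P
  rwa [chordalSup_comm Q P, max_self] at this

theorem eq_of_chordal_eq_zero {P Q : ArbP K} (h : chordal P Q = 0) : P = Q := by
  have hM : ∀ S : Arb K, 0 < max 1 (abv S) := fun S => lt_max_of_lt_left one_pos
  have hinf : ∀ S : Arb K, chordal (ArbP.of S) ArbP.infty ≠ 0 := by
    intro S hS
    simp only [chordal] at hS
    have h1 : diam S ≤ max 1 (abv S) := (diam_le_abv S).trans (le_max_right _ _)
    have h2 : diam S / max 1 (abv S) ^ 2 ≤ 1 / max 1 (abv S) := by
      rw [div_le_div_iff₀ (pow_pos (hM S) 2) (hM S)]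
      linarith [mul_le_mul_of_nonneg_right h1 (hM S).le]
    have := one_div_pos.2 (hM S)
    linarith
  rcases P with S | _ <;> rcases Q with T | _
  · have h1 := chordalSup_self_le (ArbP.of S) (ArbP.of T)
    have h2 := chordalSup_self_le (ArbP.of T) (ArbP.of S)
    rw [chordalSup_comm (ArbP.of T) (ArbP.of S)] at h2
    rw [chordal_eq] at h
    have e1 : chordalSup (ArbP.of S) (ArbP.of S) = chordalSup (ArbP.of S) (ArbP.of T) := by
      linarith
    have e2 : chordalSup (ArbP.of T) (ArbP.of T) = chordalSup (ArbP.of S) (ArbP.of T) := by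
      linarith
    simp only [chordalSup, supr_self] at e1 e2
    have hS := hM S
    have hT := hM T
    rw [div_eq_div_iff (by positivity) (by positivity)] at e1 e2
    have e1' : diam S * max 1 (abv T) = supr S T * max 1 (abv S) := by
      apply mul_left_cancel₀ hS.ne'; linarith
    have e2' : diam T * max 1 (abv S) = supr S T * max 1 (abv T) := by
      apply mul_left_cancel₀ hT.ne'; linarith
    have d1 := diam_le_supr S T
    have d2 := diam_le_supr T S
    rw [supr_comm] at d2
    have n1 := diam_nonneg S
    have n2 := diam_nonneg T
    have : dist S T ≤ 0 := by
      have hd : dist S T = supr S T - (diam S + diam T) / 2 := by rw [supr]; ring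
      rw [hd]
      rcases le_total (max 1 (abv S)) (max 1 (abv T)) with hle | hle
      · have : supr S T * max 1 (abv T) ≤ diam T * max 1 (abv T) := by
          rw [← e2']; exact mul_le_mul_of_nonneg_left hle n2
        have i2 := le_of_mul_le_mul_right this hT
        rcases eq_or_lt_of_le (n2.trans d2) with h0 | h0
        · linarith
        · have : max 1 (abv S) = max 1 (abv T) := by
            have : diam T = supr S T := le_antisymm d2 i2
            rw [this] at e2'
            exact mul_left_cancel₀ h0.ne' e2'
          rw [this] at e1'
          have := mul_right_cancel₀ hT.ne' e1'
          linarith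
      · have : supr S T * max 1 (abv S) ≤ diam S * max 1 (abv S) := by
          rw [← e1']; exact mul_le_mul_of_nonneg_left hle n1
        have i1 := le_of_mul_le_mul_right this hS
        rcases eq_or_lt_of_le (n1.trans d1) with h0 | h0
        · linarith
        · have : max 1 (abv T) = max 1 (abv S) := by
            have : diam S = supr S T := le_antisymm d1 i1
            rw [this] at e1'
            exact mul_left_cancel₀ h0.ne' e1'
          rw [this] at e2'
          have := mul_right_cancel₀ hS.ne' e2'
          linarith
    rw [dist_le_zero.1 this]
  · exact absurd h (hinf S)
  · exact absurd h (hinf T)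
  · rfl

noncomputable instance : MetricSpace (ArbP K) where
  dist := chordal
  dist_self P := by rw [chordal_eq]; ring
  dist_comm P Q := by rw [chordal_eq, chordal_eq, chordalSup_comm]; ring
  dist_triangle P Q R := by
    have h1 := chordalSup_self_le Q P
    have h2 := chordalSup_self_le Q R
    rw [chordalSup_comm Q P] at h1
    rw [chordal_eq, chordal_eq, chordal_eq]
    rcases le_max_iff.1 (chordalSup_le_max P Q R) with h | h <;> linarith
  eq_of_dist_eq_zero := eq_of_chordal_eq_zero

end ProjectiveTree

/-! ## The identification of the two spaces, and the fine topology -/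

section Fine

variable {K : Type*} [NormedField K] [IsUltrametricDist K]

/-- `ι` is the extension by continuity, for the chordal distance and the weak topology, of the map
that sends the point `[x, r]` with `r > 0`, i.e. the closed or irrational ball
`{|z - x| ≤ r}` of `K`, to the minimal Cauchy filter `F` for which `B_F` is this ball. -/
structure IsCanonicalMap (ι : ArbP K → Ber K) : Prop where
  continuous : @Continuous _ _ _ (weakTopology K) ι
  core_eq : ∀ (x : K) (r : ℝ≥0), 0 < r → core (ι (.of (pt x r))) = toP1 {z | ‖z - x‖ ≤ r}

/-- The topology of the projective tree, given by the chordal distance, transported to the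
Berkovich projective line by `ι`. -/
@[reducible] noncomputable def fineTopology (ι : ArbP K → Ber K) : TopologicalSpace (Ber K) :=
  TopologicalSpace.coinduced ι (inferInstance : TopologicalSpace (ArbP K))

end Fine

end BerkovichLine

open BerkovichLine

/-! On the projective tree consider the functions |T - a|, with value max {r, |x - a|} at [x,r] and
∞ at the point ∞ (`absSub`). Every ball of the Berkovich line is the image of the preimage, under
one such function, of an initial or final segment of [0,∞] with an endpoint r in (0,∞). The path t ↦
[a,t] (`ray`) is a continuous section of |T - a|, and each fibre is connected, since a ball [b,s]
lying over t grows inside the fibre up to [b,t] = [a,t]. Hence preimages of intervals are connected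
(`isConnected_absSub_preimage`), for the fine topology and so for the coarser weak one.

By continuity of |T - a| the frontier lies over r. A point P ≠ [a,r] over r admits some b with |T -
b| < r at P, and on the open set |T - b| < r the function |T - a| is constant (`absSub_eq_of_lt`),
so P is not in the frontier. The point [a,r] is, being approached from both sides along the ray
(`frontier_ball`). Only the continuity of the rays and of the functions |T - a| is used, so one
argument serves both topologies.

It remains to identify the minimal Cauchy filters with the points of the tree. For a Cauchy filter F
let ρ(a) be the infimum of the radii of the open balls around a that belong to F. Then ρ satisfies
the ultrametric inequalities of a ↦ |T - a|, so it comes from a point because the tree is complete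
(`exists_absSub_eq`), and F converges to that point. Conversely the neighbourhoods of a point of the
tree trace a Cauchy filter on the projective line, because finitely many balls never separate this
point from all classical points (`exists_classical_mem_iff`): the infinite residue field gives
generic points of the balls with radius in |K^*|, and density of |K^*| reaches the remaining points.
-/

namespace BerkovichLine

open scoped ENNReal

/-! ## The value group and the residue field -/

/-- The value group is dense in the half-line of positive real numbers. -/
def DenseValues (K : Type*) [NormedField K] : Prop :=
  ∀ s t : ℝ, 0 ≤ s → s < t → ∃ c ∈ valueGroup K, s < c ∧ c < t

/-- Every closed ball of radius in `|K^*|` has points in general position with respect to any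
given finite set. -/
def GenericPoints (K : Type*) [NormedField K] : Prop :=
  ∀ A : Set K, A.Finite → ∀ b : K, ∀ s ∈ valueGroup K, ∃ x : K, ∀ a ∈ A, ‖x - a‖ = max ‖b - a‖ s

theorem valueGroup_pos {K : Type*} [NormedField K] {r : ℝ} (hr : r ∈ valueGroup K) : 0 < r := by
  obtain ⟨z, hz, rfl⟩ := hr
  exact norm_pos_iff.2 hz

/-- A gap (1, ε) in the value group would isolate each value v in (v/ε, vε), by multiplicative
translation. So there are values g > 1 arbitrarily close to 1, and the powers of such a g cannot
jump over a given interval. -/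
theorem denseValues_of_not_discreteTopology {K : Type*} [NormedField K]
    (hval : ¬ DiscreteTopology (valueGroup K)) : DenseValues K := by
  have key : ∀ ε > 1, ∃ g ∈ valueGroup K, 1 < g ∧ g < ε := by
    intro ε hε
    by_contra! hno
    apply hval
    rw [discreteTopology_subtype_iff']
    rintro v ⟨y, hy, rfl⟩
    have hv : 0 < ‖y‖ := norm_pos_iff.2 hy
    refine ⟨Ioo (‖y‖ / ε) (‖y‖ * ε), isOpen_Ioo, ?_⟩
    ext w
    simp only [mem_inter_iff, mem_Ioo, mem_singleton_iff]
    constructor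
    · rintro ⟨⟨h1, h2⟩, z, hz, rfl⟩
      have hw : 0 < ‖z‖ := norm_pos_iff.2 hz
      rw [div_lt_iff₀ (by linarith)] at h1
      by_contra hne
      rcases lt_or_gt_of_ne hne with h | h
      · have := hno (‖y / z‖) ⟨y / z, div_ne_zero hy hz, rfl⟩
          (by rw [norm_div, one_lt_div hw]; exact h)
        rw [norm_div, le_div_iff₀ hw] at this
        linarith
      · have := hno (‖z / y‖) ⟨z / y, div_ne_zero hz hy, rfl⟩
          (by rw [norm_div, one_lt_div hv]; exact h)
        rw [norm_div, le_div_iff₀ hv] at this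
        linarith
    · rintro rfl
      refine ⟨⟨?_, ?_⟩, y, hy, rfl⟩
      · rw [div_lt_iff₀ (by linarith)]; nlinarith
      · nlinarith
  have pos : ∀ s t : ℝ, 0 < s → s < t → ∃ c ∈ valueGroup K, s < c ∧ c < t := by
    intro s t hs hst
    obtain ⟨g, ⟨z, hz, rfl⟩, h1, h2⟩ := key (t / s) ((one_lt_div hs).2 hst)
    obtain ⟨n, hn1, hn2⟩ := exists_mem_Ico_zpow hs h1
    refine ⟨‖z‖ ^ (n + 1), ⟨z ^ (n + 1), zpow_ne_zero _ hz, norm_zpow _ _⟩, hn2, ?_⟩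
    rw [zpow_add_one₀ (by linarith)]
    rw [lt_div_iff₀ hs] at h2
    nlinarith
  intro s t hs hst
  -- Starting from the midpoint covers the case s = 0, where powers cannot be compared with s.
  obtain ⟨c, hc, h1, h2⟩ := pos ((s + t) / 2) t (by linarith) (by linarith)
  exact ⟨c, hc, by linarith, h2⟩

/-- The point is x = b + c u with |c| = s, where the residue class of u avoids those of (a - b)/c
for the a with |b - a| ≤ s. For the other a the term b - a dominates. -/
theorem genericPoints_of_infinite_residueField {K : Type*} [NormedField K] [IsUltrametricDist K]
    (hres : Infinite
      (IsLocalRing.ResidueField (NormedField.valuation (K := K)).valuationSubring)) :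
    GenericPoints K := by
  rintro A hA b s ⟨c, hc, rfl⟩
  set O := (NormedField.valuation (K := K)).valuationSubring
  have hO : ∀ u : K, u ∈ O ↔ ‖u‖ ≤ 1 := fun u => by
    rw [Valuation.mem_valuationSubring_iff, NormedField.valuation_apply, ← NNReal.coe_le_coe]
    rfl
  have hmax : ∀ u : O, u ∈ IsLocalRing.maximalIdeal O ↔ ‖(u : K)‖ < 1 := fun u => by
    rw [IsLocalRing.mem_maximalIdeal, mem_nonunits_iff]
    exact Valuation.Integer.not_isUnit_iff_valuation_lt_one
      (v := NormedField.valuation (K := K)) (x := u)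
  classical
  -- The default value 0 only adds one class to the finite set to be avoided.
  let f : K → IsLocalRing.ResidueField O := fun a =>
    if h : (a - b) / c ∈ O then IsLocalRing.residue O ⟨_, h⟩ else 0
  obtain ⟨y, hy⟩ := (hA.image f).exists_notMem
  obtain ⟨u, rfl⟩ := IsLocalRing.residue_surjective y
  have hu : ‖(u : K)‖ ≤ 1 := (hO _).1 u.2
  have hc' : 0 < ‖c‖ := norm_pos_iff.2 hc
  refine ⟨b + c * u, fun a ha => ?_⟩
  have hcu : ‖c * (u : K)‖ ≤ ‖c‖ := by
    rw [norm_mul]; nlinarith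
  rcases le_or_gt ‖b - a‖ ‖c‖ with h | h
  · rw [max_eq_right h]
    have hm : (a - b) / c ∈ O := by
      rw [hO, norm_div, div_le_one hc', norm_sub_rev]; exact h
    have hne : IsLocalRing.residue O u ≠ IsLocalRing.residue O ⟨_, hm⟩ := by
      intro he
      apply hy
      refine ⟨a, ha, ?_⟩
      simp only [f, dif_pos hm, he]
    have h1 : ¬ ‖(u : K) - (a - b) / c‖ < 1 := by
      intro hlt
      apply hne
      rw [← sub_eq_zero, ← map_sub, IsLocalRing.residue_eq_zero_iff, hmax]
      exact hlt
    have h2 : ‖(u : K) - (a - b) / c‖ ≤ 1 := (hO _).1 (u - ⟨_, hm⟩ : O).2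
    have h3 : b + c * (u : K) - a = c * ((u : K) - (a - b) / c) := by
      field_simp; ring
    rw [h3, norm_mul, le_antisymm h2 (not_lt.1 h1), mul_one]
  · rw [max_eq_left h.le]
    have h3 : b + c * (u : K) - a = (b - a) + c * u := by ring
    rw [h3]
    rw [IsUltrametricDist.norm_add_eq_max_of_norm_ne_norm (hcu.trans_lt h).ne',
      max_eq_left (hcu.trans h.le)]

variable {K : Type*} [NormedField K] [IsUltrametricDist K]

/-! ## The tree of `K` -/

theorem continuous_supr_right (S : Arb K) : Continuous fun T : Arb K => supr S T :=
  continuous_supr.comp (Continuous.prodMk_right S)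

theorem continuous_supr_left (S : Arb K) : Continuous fun T : Arb K => supr T S :=
  continuous_supr.comp (Continuous.prodMk_left S)

theorem supr_nonneg (S T : Arb K) : 0 ≤ supr S T := (diam_nonneg S).trans (diam_le_supr S T)

theorem supr_pt_eq_max (S : Arb K) (a : K) (r : ℝ≥0) :
    supr S (pt a r) = max (supr S (pt a 0)) r :=
  isClosed_property denseRange_pt
    (isClosed_eq (continuous_supr_left _) ((continuous_supr_left _).max continuous_const))
    (fun p => by
      simp only [supr_pt, NNReal.coe_zero]
      rw [max_eq_left p.radius.coe_nonneg, max_right_comm]) S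

/-- Here a lies in the ball S, so sup {S, [a,r]} = r is the mean of the two diameters and the
distance vanishes. -/
theorem eq_pt_of_supr_le_diam {S : Arb K} {a : K} {r : ℝ≥0} (hr : diam S = r)
    (h : supr S (pt a 0) ≤ diam S) : S = pt a r := by
  have h1 : dist S (pt a r) = supr S (pt a r) - (diam S + diam (pt a r)) / 2 := by
    rw [supr]; ring
  rw [supr_pt_eq_max, diam_pt, hr, max_eq_right (by rwa [hr] at h)] at h1
  exact dist_le_zero.1 (by rw [h1]; linarith)

/-- If a lies outside S, any T with sup {S,T} < sup {S,a} has the same supremum with a, as in an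
isosceles triangle. -/
theorem eventually_supr_eq {S : Arb K} {a : K} (h : diam S < supr S (pt a 0)) :
    ∀ᶠ T in 𝓝 S, supr T (pt a 0) = supr S (pt a 0) := by
  have h1 : ∀ᶠ T in 𝓝 S, supr S T < supr S (pt a 0) := by
    refine (continuous_supr_right S).continuousAt.eventually_lt continuousAt_const ?_
    rwa [supr_self]
  filter_upwards [h1] with T hT
  have h2 := supr_le_max T S (pt a 0)
  have h3 := supr_le_max S T (pt a 0)
  rw [supr_comm T S, max_eq_right hT.le] at h2
  exact le_antisymm h2 ((le_max_iff.1 h3).resolve_left (not_le.2 hT))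

/-- By density sup {S,U} = sup {T,U} for all U; the choices U = S and U = T give diam S = sup {S,T}
= diam T, hence distance 0. -/
theorem eq_of_supr_eq {S T : Arb K} (h : ∀ a : K, supr S (pt a 0) = supr T (pt a 0)) : S = T := by
  have h1 : ∀ U, supr S U = supr T U :=
    isClosed_property denseRange_pt
      (isClosed_eq (continuous_supr_right _) (continuous_supr_right _))
      (fun p => by rw [supr_pt_eq_max, h, ← supr_pt_eq_max])
  have h2 : dist S T = supr S T - (diam S + diam T) / 2 := by rw [supr]; ring
  have h3 := h1 S
  have h4 := h1 T
  rw [supr_self] at h3 h4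
  rw [supr_comm T S] at h3
  exact dist_le_zero.1 (by rw [h2]; linarith)

/-- Even a point of the completion that is not a ball is contained in balls of K of diameter
arbitrarily close to its own; b is a centre of one of them. -/
theorem exists_supr_lt {S : Arb K} {r : ℝ} (h : diam S < r) : ∃ b : K, supr S (pt b 0) < r := by
  have ho : IsOpen {T : Arb K | supr S T < r} := isOpen_lt (continuous_supr_right S)
    continuous_const
  obtain ⟨p, hp⟩ := denseRange_pt.exists_mem_open ho ⟨S, by rwa [mem_ofPred_eq, supr_self]⟩
  rw [mem_ofPred_eq, supr_pt_eq_max] at hp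
  exact ⟨p.center, (le_max_left _ _).trans_lt hp⟩

theorem dist_pt_center (a : K) (r s : ℝ≥0) : dist (pt a r) (pt a s) = |(r : ℝ) - s| / 2 := by
  rw [dist_pt, dist_self, max_eq_left (le_max_of_le_left r.coe_nonneg)]
  rcases le_total (r : ℝ) s with h | h
  · rw [max_eq_right h, abs_of_nonpos (by linarith)]; ring
  · rw [max_eq_left h, abs_of_nonneg (by linarith)]; ring

theorem continuous_pt (a : K) : Continuous (pt a) := by
  refine LipschitzWith.continuous (K := 1) (LipschitzWith.of_dist_le_mul fun r s => ?_)
  rw [dist_pt_center, NNReal.dist_eq, NNReal.coe_one]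
  have := abs_nonneg ((r : ℝ) - s)
  linarith

theorem supr_pt_center (a b : K) (r : ℝ≥0) : supr (pt b r) (pt a 0) = max (r : ℝ) (dist b a) := by
  rw [supr_pt, NNReal.coe_zero, max_eq_left r.coe_nonneg]

theorem pt_eq_pt {a b : K} {r : ℝ≥0} (h : dist b a ≤ r) : pt b r = pt a r := by
  refine eq_pt_of_supr_le_diam (diam_pt _ _) ?_
  rw [supr_pt_center, diam_pt, max_eq_left h]

theorem dense_pt_valueGroup (hd : DenseValues K) :
    Dense {S : Arb K | ∃ b : K, ∃ s : ℝ≥0, (s : ℝ) ∈ valueGroup K ∧ S = pt b s} := by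
  have h : range (fun p : PreArb K => pt p.center p.radius) ⊆
      closure {S : Arb K | ∃ b : K, ∃ s : ℝ≥0, (s : ℝ) ∈ valueGroup K ∧ S = pt b s} := by
    rintro _ ⟨⟨b, s⟩, rfl⟩
    rw [Metric.mem_closure_iff]
    intro ε hε
    obtain ⟨c, hc, h1, h2⟩ := hd s (s + ε) s.coe_nonneg (by linarith)
    lift c to ℝ≥0 using (valueGroup_pos hc).le
    refine ⟨pt b c, ⟨b, c, hc, rfl⟩, ?_⟩
    dsimp only
    rw [dist_pt_center, abs_of_nonpos (by linarith)]
    linarith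
  intro S
  exact closure_minimal h isClosed_closure (denseRange_pt S)

/-! ## The functions `|T - a|` on the projective tree -/

/-- The value at a point of the projective tree of the function `|T - a|`. -/
noncomputable def absSub (a : K) : ArbP K → ℝ≥0∞
  | .of S => ENNReal.ofReal (supr S (pt a 0))
  | .infty => ⊤

@[simp] theorem absSub_of (a : K) (S : Arb K) :
    absSub a (.of S) = ENNReal.ofReal (supr S (pt a 0)) := rfl

@[simp] theorem absSub_infty (a : K) : absSub a (.infty : ArbP K) = ⊤ := rfl

theorem absSub_pt (a b : K) (r : ℝ≥0) :
    absSub a (.of (pt b r)) = max (r : ℝ≥0∞) (edist b a) := by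
  rw [absSub_of, supr_pt_center, ENNReal.ofReal_max, ENNReal.ofReal_coe_nnreal, edist_dist]

theorem absSub_le_max (a b : K) (P : ArbP K) : absSub a P ≤ max (absSub b P) (edist b a) := by
  rcases P with S | _
  · rw [absSub_of, absSub_of, edist_dist, ← ENNReal.ofReal_max]
    refine ENNReal.ofReal_le_ofReal ((supr_le_max _ (pt b 0) _).trans ?_)
    rw [supr_pt_center, NNReal.coe_zero, max_eq_right dist_nonneg]
  · simp

theorem edist_le_max_absSub (a b : K) (P : ArbP K) :
    edist b a ≤ max (absSub b P) (absSub a P) := by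
  rcases P with S | _
  · rw [absSub_of, absSub_of, edist_dist, ← ENNReal.ofReal_max]
    refine ENNReal.ofReal_le_ofReal (le_trans ?_ (supr_le_max (pt b 0) S (pt a 0)))
      |>.trans (by rw [supr_comm])
    rw [supr_pt_center]
    exact le_max_right _ _
  · simp

theorem eq_of_absSub_eq {P Q : ArbP K} (h : ∀ a, absSub a P = absSub a Q) : P = Q := by
  rcases P with S | _ <;> rcases Q with T | _
  · congr 1
    refine eq_of_supr_eq fun a => ?_
    have := h a
    rwa [absSub_of, absSub_of, ENNReal.ofReal_eq_ofReal_iff (supr_nonneg _ _) (supr_nonneg _ _)]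
      at this
  · simpa using h 0
  · simpa using (h 0).symm
  · rfl

/-- Both sides equal |b - a|. This is the local constancy of |T - a| off the ray from a. -/
theorem absSub_eq_of_lt {a b : K} {P Q : ArbP K} (h : absSub b P < absSub a P)
    (h' : absSub b Q < absSub a P) : absSub a Q = absSub a P := by
  have h1 : absSub a P ≤ edist b a := (le_max_iff.1 (absSub_le_max a b P)).resolve_left
    (not_le.2 h)
  have h2 : edist b a ≤ absSub a P := (edist_le_max_absSub a b P).trans (max_le h.le le_rfl)
  refine le_antisymm ((absSub_le_max a b Q).trans (max_le h'.le h2)) ?_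
  exact (le_max_iff.1 (h1.trans (edist_le_max_absSub a b Q))).resolve_left (not_le.2 h')

/-! ## Continuity for the chordal distance -/

theorem abs_chordalSup_self_sub_le (P Q : ArbP K) :
    |chordalSup P P - chordalSup Q Q| ≤ 2 * dist P Q := by
  have h1 := chordalSup_self_le P Q
  have h2 := chordalSup_self_le Q P
  rw [chordalSup_comm Q P] at h2
  have h3 : dist P Q = chordalSup P Q - chordalSup P P / 2 - chordalSup Q Q / 2 := chordal_eq P Q
  rw [h3, abs_le]
  constructor <;> linarith

theorem continuous_chordalSup_self : Continuous fun P : ArbP K => chordalSup P P := by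
  refine LipschitzWith.continuous (K := 2) (LipschitzWith.of_dist_le_mul fun P Q => ?_)
  exact abs_chordalSup_self_sub_le P Q

theorem continuous_chordalSup_left (Q : ArbP K) : Continuous fun P : ArbP K => chordalSup P Q := by
  have h : (fun P : ArbP K => chordalSup P Q) =
      fun P => dist P Q + chordalSup P P / 2 + chordalSup Q Q / 2 := by
    funext P
    have h3 : dist P Q = chordalSup P Q - chordalSup P P / 2 - chordalSup Q Q / 2 :=
      chordal_eq P Q
    rw [h3]; ring
  rw [h]
  have := continuous_chordalSup_self (K := K)
  fun_prop

/-- Up to a constant factor, |T - a| is the quotient of the chordal suprema with [a,0] and with ∞,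
each continuous for the chordal distance. -/
theorem continuous_absSub (a : K) : Continuous (absSub a : ArbP K → ℝ≥0∞) := by
  have h : (absSub a : ArbP K → ℝ≥0∞) = fun P =>
      ENNReal.ofReal (chordalSup P (.of (pt a 0)) * max 1 (abv (pt a 0))) /
        ENNReal.ofReal (chordalSup P .infty) := by
    funext P
    have ha : 0 < max 1 (abv (pt a 0)) := lt_max_of_lt_left one_pos
    rcases P with S | _
    · have hS : 0 < max 1 (abv S) := lt_max_of_lt_left one_pos
      simp only [chordalSup]
      rw [← ENNReal.ofReal_div_of_pos (by positivity), absSub_of]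
      congr 1
      field_simp
    · simp [chordalSup, ha.ne']
  rw [h, continuous_iff_continuousAt]
  intro P
  refine ENNReal.Tendsto.div
    ((ENNReal.continuous_ofReal.comp ((continuous_chordalSup_left _).mul_const _)).tendsto P)
    ?_ ((ENNReal.continuous_ofReal.comp (continuous_chordalSup_left _)).tendsto P)
    (.inl ENNReal.ofReal_ne_top)
  -- The form 0/0 does not occur: the denominator is positive on the tree, the numerator at ∞.
  rcases P with S | _
  · right
    simp only [chordalSup]
    rw [Ne, ENNReal.ofReal_eq_zero, not_le]
    have hS : 0 < max 1 (abv S) := lt_max_of_lt_left one_pos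
    positivity
  · left
    have ha : 0 < max 1 (abv (pt a 0)) := lt_max_of_lt_left one_pos
    simp only [chordalSup]
    rw [Ne, ENNReal.ofReal_eq_zero, not_le]
    positivity

theorem continuous_of : Continuous (ArbP.of : Arb K → ArbP K) := by
  rw [continuous_iff_continuousAt]
  intro S
  rw [ContinuousAt, tendsto_iff_dist_tendsto_zero]
  have hM : ∀ S : Arb K, max 1 (abv S) ≠ 0 := fun S => (lt_max_of_lt_left one_pos).ne'
  have habv : Continuous (abv : Arb K → ℝ) := continuous_supr_left _
  have hc : Continuous fun T : Arb K => dist (ArbP.of T) (ArbP.of S) := by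
    change Continuous fun T : Arb K => supr T S / (max 1 (abv T) * max 1 (abv S)) -
      diam T / max 1 (abv T) ^ 2 / 2 - diam S / max 1 (abv S) ^ 2 / 2
    have h1 := continuous_supr_left S
    have h2 := continuous_diam (K := K)
    have h3 : Continuous fun T : Arb K => max 1 (abv T) := continuous_const.max habv
    refine ((h1.div (h3.mul continuous_const) fun T => mul_ne_zero (hM T) (hM S)).sub
      ((h2.div (h3.pow 2) fun T => pow_ne_zero 2 (hM T)).div_const 2)).sub continuous_const
  simpa using hc.tendsto S

/-- The path `t ↦ [a, t]` from `a` to `∞` in the projective tree. -/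
noncomputable def ray (a : K) (t : ℝ≥0∞) : ArbP K :=
  if t = ⊤ then .infty else .of (pt a t.toNNReal)

@[simp] theorem ray_coe (a : K) (t : ℝ≥0) : ray a t = .of (pt a t) := by simp [ray]

@[simp] theorem ray_top (a : K) : ray a ⊤ = .infty := by simp [ray]

@[simp] theorem absSub_ray (a : K) (t : ℝ≥0∞) : absSub a (ray a t) = t := by
  rcases eq_or_ne t ⊤ with rfl | h
  · simp
  · lift t to ℝ≥0 using h
    simp [absSub_pt, -absSub_of]

theorem continuous_ray (a : K) : Continuous (ray a) := by
  rw [continuous_iff_continuousAt]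
  intro t
  rcases eq_or_ne t ⊤ with rfl | h
  · rw [ContinuousAt, ray_top, tendsto_iff_dist_tendsto_zero]
    have h0 : Tendsto (fun t : ℝ≥0∞ => t⁻¹.toReal) (𝓝 ⊤) (𝓝 0) := by
      have h1 : Tendsto (fun t : ℝ≥0∞ => t⁻¹) (𝓝 ⊤) (𝓝 0) := by
        simpa using (continuous_inv (G := ℝ≥0∞)).tendsto ⊤
      exact (ENNReal.tendsto_toReal ENNReal.zero_ne_top).comp h1
    -- Near ∞ the chordal distance from [a,t] to ∞ is at most 1/t.
    refine squeeze_zero' (Eventually.of_forall fun _ => dist_nonneg) ?_ h0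
    filter_upwards [lt_mem_nhds (ENNReal.zero_lt_top)] with t ht
    rcases eq_or_ne t ⊤ with rfl | h
    · simp
    · lift t to ℝ≥0 using h
      rw [ray_coe]
      have ht' : 0 < (t : ℝ) := by simpa using ht
      change 1 / max 1 (abv (pt a t)) - diam (pt a t) / max 1 (abv (pt a t)) ^ 2 / 2 ≤ _
      have h1 : 1 / max 1 (abv (pt a t)) ≤ 1 / t := by
        refine one_div_le_one_div_of_le ht' (le_max_of_le_right ?_)
        rw [abv_pt]
        exact le_max_right _ _
      have h2 : 0 ≤ diam (pt a t) / max 1 (abv (pt a t)) ^ 2 / 2 :=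
        div_nonneg (div_nonneg (diam_nonneg _) (sq_nonneg _)) (by norm_num)
      rw [ENNReal.toReal_inv, ENNReal.coe_toReal, ← one_div]
      linarith
  · lift t to ℝ≥0 using h
    rw [ENNReal.continuousAt_coe_iff]
    have : ray a ∘ ((↑) : ℝ≥0 → ℝ≥0∞) = fun t => .of (pt a t) := funext fun t => ray_coe a t
    rw [this]
    exact (continuous_of.comp (continuous_pt a)).continuousAt

/-- Either a belongs to the ball S, and then S lies on the ray from a, or diam S < sup {S,a} and
some centre b is strictly closer to S than a. -/
theorem ray_absSub_or_exists_lt {a : K} {P : ArbP K} (h : absSub a P ≠ ⊤) :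
    P = ray a (absSub a P) ∨ ∃ b, absSub b P < absSub a P := by
  rcases P with S | _
  · rcases eq_or_lt_of_le (diam_le_supr S (pt a 0)) with he | hlt
    · left
      rw [absSub_of, ENNReal.ofReal, ray_coe]
      congr 1
      exact eq_pt_of_supr_le_diam (by rw [he, Real.coe_toNNReal _ (supr_nonneg _ _)]) he.ge
    · right
      obtain ⟨b, hb⟩ := exists_supr_lt hlt
      exact ⟨b, (ENNReal.ofReal_lt_ofReal_iff_of_nonneg (supr_nonneg _ _)).2 hb⟩
  · simp at h

/-- Approximation by balls without leaving the fibre: S is either itself on the ray from a, or a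
point near which |T - a| is constant, so that balls close to S stay in the fibre. -/
theorem mem_closure_pt_of_absSub_eq (a : K) (S : Arb K) :
    ArbP.of S ∈ closure {P | ∃ b : K, ∃ s : ℝ≥0, P = .of (pt b s) ∧
      absSub a P = absSub a (.of S)} := by
  rcases eq_or_lt_of_le (diam_le_supr S (pt a 0)) with he | hlt
  · refine subset_closure ⟨a, (diam S).toNNReal, ?_, rfl⟩
    congr 1
    exact eq_pt_of_supr_le_diam (by rw [Real.coe_toNNReal _ (diam_nonneg _)]) he.ge
  · have h1 : S ∈ closure {T | (∃ b : K, ∃ s : ℝ≥0, T = pt b s) ∧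
        supr T (pt a 0) = supr S (pt a 0)} := by
      rw [mem_closure_iff_frequently]
      refine Frequently.mono ((mem_closure_iff_frequently.1 (denseRange_pt S)).and_eventually
        (eventually_supr_eq hlt)) ?_
      rintro T ⟨⟨p, rfl⟩, h⟩
      exact ⟨⟨_, _, rfl⟩, h⟩
    refine closure_mono ?_ (image_closure_subset_closure_image continuous_of ⟨S, h1, rfl⟩)
    rintro _ ⟨T, ⟨⟨b, s, rfl⟩, h⟩, rfl⟩
    exact ⟨b, s, rfl, by rw [absSub_of, absSub_of, h]⟩

/-- Radius 0 and the point ∞ are reached as limits along rays. This density makes the canonical map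
unique. -/
theorem dense_pt_pos : Dense {P : ArbP K | ∃ x : K, ∃ r : ℝ≥0, 0 < r ∧ P = .of (pt x r)} := by
  have h1 : ∀ (x : K) (t : ℝ≥0∞), ray x t ∈
      closure {P : ArbP K | ∃ x : K, ∃ r : ℝ≥0, 0 < r ∧ P = .of (pt x r)} := by
    intro x t
    have hd : t ∈ closure (Ioo (0 : ℝ≥0∞) ⊤) := by
      rw [closure_Ioo ENNReal.zero_lt_top.ne]; simp
    refine closure_mono ?_ (image_closure_subset_closure_image (continuous_ray x) ⟨t, hd, rfl⟩)
    rintro _ ⟨t, ⟨h1, h2⟩, rfl⟩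
    lift t to ℝ≥0 using h2.ne
    exact ⟨x, t, by simpa using h1, ray_coe _ _⟩
  rintro (S | _)
  · refine closure_minimal ?_ isClosed_closure (mem_closure_pt_of_absSub_eq 0 S)
    rintro _ ⟨b, s, rfl, -⟩
    simpa using h1 b s
  · simpa using h1 0 ⊤

/-! ## Connectedness -/

/-- A ball [b,s] of the fibre is joined to [a,t] by the segment of the [b,u], s ≤ u ≤ t, which stays
in the fibre. The remaining points are limits of balls of the fibre. -/
theorem isPreconnected_absSub_fiber (a : K) (t : ℝ≥0∞) :
    IsPreconnected {P : ArbP K | absSub a P = t} := by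
  rcases eq_or_ne t ⊤ with rfl | ht
  · convert isPreconnected_singleton (x := (ArbP.infty : ArbP K))
    ext P
    rcases P with S | _ <;> simp
  have h : IsPreconnected {P : ArbP K | ∃ b : K, ∃ s : ℝ≥0, P = .of (pt b s) ∧
      absSub a P = t} := by
    refine isPreconnected_of_forall (ray a t) ?_
    rintro _ ⟨b, s, rfl, h⟩
    rw [absSub_pt] at h
    have hst : (s : ℝ≥0∞) ≤ t := h ▸ le_max_left _ _
    have hbt : edist b a ≤ t := h ▸ le_max_right _ _
    have hray : ray b t = ray a t := by
      lift t to ℝ≥0 using ht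
      rw [ray_coe, ray_coe, pt_eq_pt]
      rw [edist_nndist, ENNReal.coe_le_coe] at hbt
      exact hbt
    refine ⟨ray b '' Icc s t, ?_, ⟨t, ⟨hst, le_rfl⟩, hray⟩, ⟨s, ⟨le_rfl, hst⟩, ray_coe _ _⟩,
      isPreconnected_Icc.image _ (continuous_ray b).continuousOn⟩
    rintro _ ⟨u, ⟨hu, hut⟩, rfl⟩
    lift u to ℝ≥0 using (hut.trans_lt ht.lt_top).ne
    refine ⟨b, u, ray_coe _ _, ?_⟩
    rw [ray_coe, absSub_pt]
    refine le_antisymm (max_le hut hbt) ?_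
    rw [← h]
    exact max_le_max hu le_rfl
  refine h.subset_closure ?_ ?_
  · rintro _ ⟨b, s, rfl, h⟩
    exact h
  · rintro (S | _) hS
    · refine closure_mono ?_ (mem_closure_pt_of_absSub_eq a S)
      rintro P ⟨b, s, rfl, h⟩
      exact ⟨b, s, rfl, h.trans hS⟩
    · exact absurd hS.symm ht

/-- The part of the ray over I is connected, and the connected fibre through any given point meets
it. -/
theorem isConnected_absSub_preimage (a : K) {I : Set ℝ≥0∞} (hI : I.OrdConnected)
    (hne : I.Nonempty) : IsConnected (absSub a ⁻¹' I : Set (ArbP K)) := by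
  obtain ⟨t, ht⟩ := hne
  refine ⟨⟨ray a t, by simpa using ht⟩, isPreconnected_of_forall (ray a t) fun P hP => ?_⟩
  have hI' : IsPreconnected (ray a '' I) :=
    hI.isPreconnected.image _ (continuous_ray a).continuousOn
  refine ⟨ray a '' I ∪ {Q | absSub a Q = absSub a P}, ?_, .inl ⟨t, ht, rfl⟩, .inr rfl,
    hI'.union (ray a (absSub a P)) ⟨_, hP, rfl⟩ (absSub_ray _ _)
      (isPreconnected_absSub_fiber a _)⟩
  rintro _ (⟨u, hu, rfl⟩ | h)
  · simpa using hu
  · rw [mem_preimage, h]; exact hP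

/-! ## The weak topology of the projective tree -/

/-- The traces on the projective tree of the open balls. -/
def IsBasicOpen (G : Set (ArbP K)) : Prop :=
  ∃ a : K, ∃ r ∈ valueGroup K,
    G = {P | absSub a P < ENNReal.ofReal r} ∨ G = {P | ENNReal.ofReal r < absSub a P}

variable (K) in
/-- The weak topology of the projective tree. -/
@[reducible] def weakTree : TopologicalSpace (ArbP K) :=
  TopologicalSpace.generateFrom {G | IsBasicOpen G}

/-- The points of the projective line, seen in the projective tree. -/
noncomputable def classical : P1 K → ArbP K
  | (x : K) => .of (pt x 0)
  | OnePoint.infty => .infty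

@[simp] theorem classical_coe (x : K) : classical (x : P1 K) = .of (pt x 0) := rfl

@[simp] theorem classical_infty : classical (OnePoint.infty : P1 K) = .infty := rfl

theorem absSub_classical_coe (a x : K) : absSub a (classical (x : P1 K)) = edist x a := by
  rw [classical_coe, absSub_pt]; simp

theorem toP1_lt (a : K) {r : ℝ} (hr : 0 < r) :
    toP1 {z | ‖z - a‖ < r} = classical ⁻¹' {P | absSub a P < ENNReal.ofReal r} := by
  ext x
  induction x using OnePoint.rec with
  | infty => simp [toP1]
  | coe x =>
    rw [mem_preimage, mem_ofPred_eq, absSub_classical_coe, edist_dist,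
      ENNReal.ofReal_lt_ofReal_iff hr, dist_eq_norm]
    simp [toP1]

theorem toP1_le (a : K) {r : ℝ} (hr : 0 < r) :
    toP1 {z | ‖z - a‖ ≤ r} = classical ⁻¹' {P | absSub a P ≤ ENNReal.ofReal r} := by
  ext x
  induction x using OnePoint.rec with
  | infty => simp [toP1]
  | coe x =>
    rw [mem_preimage, mem_ofPred_eq, absSub_classical_coe, edist_dist,
      ENNReal.ofReal_le_ofReal_iff hr.le, dist_eq_norm]
    simp [toP1]

theorem compl_toP1_le (a : K) {r : ℝ} (hr : 0 < r) :
    (toP1 {z | ‖z - a‖ ≤ r})ᶜ = classical ⁻¹' {P | ENNReal.ofReal r < absSub a P} := by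
  rw [toP1_le a hr]; ext x; simp

theorem compl_toP1_lt (a : K) {r : ℝ} (hr : 0 < r) :
    (toP1 {z | ‖z - a‖ < r})ᶜ = classical ⁻¹' {P | ENNReal.ofReal r ≤ absSub a P} := by
  rw [toP1_lt a hr]; ext x; simp

theorem isOpenBall_iff {B : Set (P1 K)} :
    IsOpenBall B ↔ ∃ G, IsBasicOpen G ∧ B = classical ⁻¹' G := by
  constructor
  · rintro ⟨D, ⟨⟨a, r, hr, rfl⟩, rfl⟩ | ⟨⟨a, r, hr, rfl⟩, rfl⟩⟩
    · exact ⟨_, ⟨a, r, hr, .inl rfl⟩, toP1_lt a (valueGroup_pos hr)⟩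
    · exact ⟨_, ⟨a, r, hr, .inr rfl⟩, compl_toP1_le a (valueGroup_pos hr)⟩
  · rintro ⟨G, ⟨a, r, hr, rfl | rfl⟩, rfl⟩
    · exact ⟨_, .inl ⟨⟨a, r, hr, rfl⟩, (toP1_lt a (valueGroup_pos hr)).symm⟩⟩
    · exact ⟨_, .inr ⟨⟨a, r, hr, rfl⟩, (compl_toP1_le a (valueGroup_pos hr)).symm⟩⟩

theorem IsOpenAffinoid.exists_basicOpen {Y : Set (P1 K)} (hY : IsOpenAffinoid Y) :
    ∃ T : Set (Set (ArbP K)), T.Finite ∧ (∀ G ∈ T, IsBasicOpen G) ∧ Y = classical ⁻¹' ⋂₀ T := by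
  obtain ⟨S, hS, hSb, rfl⟩ := hY
  choose! f hf hf' using fun B hB => isOpenBall_iff.1 (hSb B hB)
  refine ⟨f '' S, hS.image f, ?_, ?_⟩
  · rintro _ ⟨B, hB, rfl⟩; exact hf B hB
  · rw [preimage_sInter, biInter_image, sInter_eq_biInter]
    exact iInter₂_congr hf'

theorem IsBasicOpen.isOpenAffinoid {G : Set (ArbP K)} (hG : IsBasicOpen G) :
    IsOpenAffinoid (classical ⁻¹' G) :=
  ⟨{classical ⁻¹' G}, finite_singleton _, by simpa using isOpenBall_iff.2 ⟨G, hG, rfl⟩, by simp⟩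

theorem isAffinoidCover_pair {G H : Set (ArbP K)} (hG : IsBasicOpen G) (hH : IsBasicOpen H)
    (h : G ∪ H = univ) : IsAffinoidCover {classical ⁻¹' G, classical ⁻¹' H} := by
  refine ⟨by simp, ?_, ?_⟩
  · rintro Y (rfl | rfl)
    exacts [hG.isOpenAffinoid, hH.isOpenAffinoid]
  · rw [sUnion_pair, ← preimage_union, h, preimage_univ]

/-- A finite family of balls does not separate a point of the projective tree from all the points
of the projective line. -/
theorem exists_classical_mem_iff (hd : DenseValues K) (hg : GenericPoints K) (P : ArbP K)
    {T : Set (Set (ArbP K))} (hT : T.Finite) (hb : ∀ G ∈ T, IsBasicOpen G) :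
    ∃ x : P1 K, ∀ G ∈ T, classical x ∈ G ↔ P ∈ G := by
  rcases P with S | _
  swap
  · exact ⟨OnePoint.infty, fun G _ => Iff.rfl⟩
  -- At [b,s] with s in |K^*|, a point x generic with respect to the centres of the balls of T has
  -- the same values |x - a| as [b,s].
  have res : ∀ (b : K) (s : ℝ≥0), (s : ℝ) ∈ valueGroup K →
      ∃ x : P1 K, ∀ G ∈ T, classical x ∈ G ↔ .of (pt b s) ∈ G := by
    intro b s hs
    choose! c r hr hc using hb
    obtain ⟨x, hx⟩ := hg (c '' T) (hT.image c) b s hs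
    refine ⟨x, fun G hG => ?_⟩
    have : absSub (c G) (classical (x : P1 K)) = absSub (c G) (.of (pt b s)) := by
      rw [absSub_classical_coe, absSub_of, supr_pt_center, edist_dist, dist_eq_norm, dist_eq_norm,
        hx _ ⟨G, hG, rfl⟩, max_comm]
    rcases hc G hG with h | h <;> rw [h, mem_ofPred_eq, mem_ofPred_eq, this]
  by_cases hS : ∃ b : K, ∃ s : ℝ≥0, (s : ℝ) ∈ valueGroup K ∧ S = pt b s
  · obtain ⟨b, s, hs, rfl⟩ := hS
    exact res b s hs
  -- Any other S has a neighbourhood on which membership in the balls of T is constant: either a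
  -- lies in S and |T - a| differs from r at S (otherwise S would be [a,r] with r in |K^*|), or |T -
  -- a| is constant near S.
  have hev : ∀ᶠ U in 𝓝 S, ∀ G ∈ T, ArbP.of U ∈ G ↔ .of S ∈ G := by
    rw [hT.eventually_all]
    intro G hG
    obtain ⟨a, r, hr, hG⟩ := hb G hG
    rcases eq_or_lt_of_le (diam_le_supr S (pt a 0)) with he | hlt
    · have hne : absSub a (.of S) ≠ ENNReal.ofReal r := by
        intro h
        rw [absSub_of, ENNReal.ofReal_eq_ofReal_iff (supr_nonneg _ _) (valueGroup_pos hr).le] at h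
        refine hS ⟨a, (diam S).toNNReal, ?_, eq_pt_of_supr_le_diam ?_ he.ge⟩
        · rwa [Real.coe_toNNReal _ (diam_nonneg _), he, h]
        · rw [Real.coe_toNNReal _ (diam_nonneg _)]
      have hcont : Continuous fun U : Arb K => absSub a (.of U) :=
        (continuous_absSub a).comp continuous_of
      rcases lt_or_gt_of_ne hne with h | h
      · filter_upwards [hcont.continuousAt.eventually_lt continuousAt_const h] with U hU
        rcases hG with rfl | rfl
        · simp only [mem_ofPred_eq, hU, h]
        · simp only [mem_ofPred_eq, hU.not_gt, h.not_gt]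
      · filter_upwards [continuousAt_const.eventually_lt hcont.continuousAt h] with U hU
        rcases hG with rfl | rfl
        · simp only [mem_ofPred_eq, hU.not_gt, h.not_gt]
        · simp only [mem_ofPred_eq, hU, h]
    · filter_upwards [eventually_supr_eq hlt] with U hU
      rcases hG with rfl | rfl <;> simp only [mem_ofPred_eq, absSub_of, hU]
  obtain ⟨U, ⟨b, s, hs, rfl⟩, hU⟩ :=
    ((mem_closure_iff_frequently.1 (dense_pt_valueGroup hd S)).and_eventually hev).exists
  obtain ⟨x, hx⟩ := res b s hs
  exact ⟨x, fun G hG => (hx G hG).trans (hU G hG)⟩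

omit [IsUltrametricDist K] in
theorem DenseValues.exists_between (hd : DenseValues K) {s t : ℝ≥0∞} (h : s < t) :
    ∃ r ∈ valueGroup K, s < ENNReal.ofReal r ∧ ENNReal.ofReal r < t := by
  obtain ⟨u, hsu, hut⟩ := _root_.exists_between h
  have hu : u ≠ ⊤ := (hut.trans_le le_top).ne
  obtain ⟨c, hc, h1, h2⟩ := hd s.toReal u.toReal ENNReal.toReal_nonneg
    ((ENNReal.toReal_lt_toReal (hsu.trans hu.lt_top).ne hu).2 hsu)
  refine ⟨c, hc, ?_, lt_trans ?_ hut⟩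
  · rwa [ENNReal.lt_ofReal_iff_toReal_lt (hsu.trans hu.lt_top).ne]
  · rwa [ENNReal.ofReal_lt_iff_lt_toReal (valueGroup_pos hc).le hu]

/-! ### Comparison of the weak and chordal topologies -/

theorem isOpen_weakTree_basicOpen {G : Set (ArbP K)} (hG : IsBasicOpen G) : IsOpen[weakTree K] G :=
  TopologicalSpace.isOpen_generateFrom_of_mem hG

theorem continuous_weakTree_absSub (hd : DenseValues K) (a : K) :
    @Continuous _ _ (weakTree K) _ (absSub a : ArbP K → ℝ≥0∞) := by
  let _ := weakTree K
  rw [OrderTopology.continuous_iff]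
  intro c
  constructor
  · have : absSub a ⁻¹' Ioi c = ⋃ r ∈ {r | r ∈ valueGroup K ∧ c ≤ ENNReal.ofReal r},
        {P : ArbP K | ENNReal.ofReal r < absSub a P} := by
      ext P
      simp only [mem_preimage, mem_Ioi, mem_iUnion, mem_ofPred_eq, exists_prop]
      constructor
      · intro h
        obtain ⟨r, hr, h1, h2⟩ := hd.exists_between h
        exact ⟨r, ⟨hr, h1.le⟩, h2⟩
      · rintro ⟨r, ⟨-, h1⟩, h2⟩
        exact h1.trans_lt h2
    rw [this]
    exact isOpen_biUnion fun r hr => isOpen_weakTree_basicOpen ⟨a, r, hr.1, .inr rfl⟩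
  · have : absSub a ⁻¹' Iio c = ⋃ r ∈ {r | r ∈ valueGroup K ∧ ENNReal.ofReal r ≤ c},
        {P : ArbP K | absSub a P < ENNReal.ofReal r} := by
      ext P
      simp only [mem_preimage, mem_Iio, mem_iUnion, mem_ofPred_eq, exists_prop]
      constructor
      · intro h
        obtain ⟨r, hr, h1, h2⟩ := hd.exists_between h
        exact ⟨r, ⟨hr, h2.le⟩, h1⟩
      · rintro ⟨r, ⟨-, h1⟩, h2⟩
        exact h2.trans_le h1
    rw [this]
    exact isOpen_biUnion fun r hr => isOpen_weakTree_basicOpen ⟨a, r, hr.1, .inl rfl⟩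

variable (K) in
/-- The fine topology of the projective tree, given by the chordal distance. -/
@[reducible] noncomputable def fineTree : TopologicalSpace (ArbP K) := inferInstance

theorem fineTree_le_weakTree : fineTree K ≤ weakTree K := by
  refine le_generateFrom ?_
  rintro _ ⟨a, r, -, rfl | rfl⟩
  · exact isOpen_lt (continuous_absSub a) continuous_const
  · exact isOpen_lt continuous_const (continuous_absSub a)

theorem isTopologicalBasis_weakTree : @TopologicalSpace.IsTopologicalBasis _ (weakTree K)
    ((fun T : Set (Set (ArbP K)) => ⋂₀ T) '' {T | T.Finite ∧ T ⊆ {G | IsBasicOpen G}}) :=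
  @TopologicalSpace.isTopologicalBasis_of_subbasis _ (weakTree K) _ rfl

theorem mem_nhds_weakTree {P : ArbP K} {U : Set (ArbP K)} :
    U ∈ @nhds _ (weakTree K) P ↔ ∃ T : Set (Set (ArbP K)), T.Finite ∧ (∀ G ∈ T, IsBasicOpen G) ∧
      P ∈ ⋂₀ T ∧ ⋂₀ T ⊆ U := by
  rw [@TopologicalSpace.IsTopologicalBasis.mem_nhds_iff _ (weakTree K) _ _ _
    isTopologicalBasis_weakTree]
  constructor
  · rintro ⟨_, ⟨T, ⟨h1, h2⟩, rfl⟩, h3, h4⟩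
    exact ⟨T, h1, h2, h3, h4⟩
  · rintro ⟨T, h1, h2, h3, h4⟩
    exact ⟨_, ⟨T, ⟨h1, h2⟩, rfl⟩, h3, h4⟩

theorem denseRange_classical (hd : DenseValues K) (hg : GenericPoints K) :
    @DenseRange _ (weakTree K) _ (classical : P1 K → ArbP K) := by
  let _ := weakTree K
  intro P
  rw [mem_closure_iff_nhds]
  intro U hU
  obtain ⟨T, hT, hb, hP, hTU⟩ := mem_nhds_weakTree.1 hU
  obtain ⟨x, hx⟩ := exists_classical_mem_iff hd hg P hT hb
  exact ⟨_, hTU fun G hG => (hx G hG).2 (hP G hG), x, rfl⟩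

/-- A covering of the projective line extends to the tree. Choose a classical x that lies in the
same balls as P, among the finitely many defining the covering; a member containing x has an
extension containing P. -/
theorem IsAffinoidCover.exists_mem_nhds (hd : DenseValues K) (hg : GenericPoints K)
    {C : Set (Set (P1 K))} (hC : IsAffinoidCover C) (P : ArbP K) :
    ∃ Y ∈ C, ∃ U, IsOpen[weakTree K] U ∧ P ∈ U ∧ Y = classical ⁻¹' U := by
  choose! f hf hfb hf' using fun Y hY => (hC.2.1 Y hY).exists_basicOpen
  have hfin : (⋃ Y ∈ C, f Y).Finite := hC.1.biUnion hf
  obtain ⟨x, hx⟩ := exists_classical_mem_iff hd hg P hfin (by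
    simp only [mem_iUnion]
    rintro G ⟨Y, hY, hG⟩
    exact hfb Y hY G hG)
  obtain ⟨Y, hY, hxY⟩ : x ∈ ⋃₀ C := hC.2.2 ▸ mem_univ x
  refine ⟨Y, hY, ⋂₀ f Y, ?_, ?_, hf' Y hY⟩
  · let _ := weakTree K
    exact (hf Y hY).isOpen_sInter fun G hG => isOpen_weakTree_basicOpen (hfb Y hY G hG)
  · intro G hG
    rw [hf' Y hY] at hxY
    exact (hx G (mem_biUnion hY hG)).1 (hxY G hG)

/-- A radius strictly between r and the value at P yields a smaller ball G' and an opposite ball H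
overlapping G, so that {G, H} is a covering. -/
theorem IsBasicOpen.exists_shrink (hd : DenseValues K) {G : Set (ArbP K)} (hG : IsBasicOpen G)
    {P : ArbP K} (hP : P ∈ G) :
    ∃ G' H, IsBasicOpen G' ∧ IsBasicOpen H ∧ P ∈ G' ∧ Disjoint G' H ∧ G ∪ H = univ := by
  obtain ⟨a, r, hr, rfl | rfl⟩ := hG
  · obtain ⟨s, hs, h1, h2⟩ := hd.exists_between hP
    refine ⟨_, _, ⟨a, s, hs, .inl rfl⟩, ⟨a, s, hs, .inr rfl⟩, h1, ?_, ?_⟩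
    · exact disjoint_left.2 fun Q (hQ : absSub a Q < _) (hQ' : _ < absSub a Q) =>
      lt_asymm hQ hQ'
    · refine eq_univ_of_forall fun Q => ?_
      exact (lt_or_ge (absSub a Q) (ENNReal.ofReal r)).imp id h2.trans_le
  · obtain ⟨s, hs, h1, h2⟩ := hd.exists_between hP
    refine ⟨_, _, ⟨a, s, hs, .inr rfl⟩, ⟨a, s, hs, .inl rfl⟩, h2, ?_, ?_⟩
    · exact disjoint_left.2 fun Q (hQ : _ < absSub a Q) (hQ' : absSub a Q < _) =>
      lt_asymm hQ hQ'
    · refine eq_univ_of_forall fun Q => ?_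
      exact (lt_or_ge (ENNReal.ofReal r) (absSub a Q)).imp id fun h => h.trans_lt h1

theorem exists_entourage_subset (hd : DenseValues K) {P : ArbP K} {W : Set (ArbP K)}
    (hW : W ∈ @nhds _ (weakTree K) P) :
    ∃ V ∈ entourages K, ∃ U ∈ @nhds _ (weakTree K) P, ∀ x y : P1 K, classical x ∈ U →
      (x, y) ∈ V → classical y ∈ W := by
  obtain ⟨T, hT, hb, hP, hTW⟩ := mem_nhds_weakTree.1 hW
  have key : ∀ G ∈ T, ∃ V ∈ entourages K, ∃ U ∈ @nhds _ (weakTree K) P, ∀ x y : P1 K,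
      classical x ∈ U → (x, y) ∈ V → classical y ∈ G := by
    intro G hG
    obtain ⟨G', H, hG', hH, hPG, hdis, hun⟩ := (hb G hG).exists_shrink hd (hP G hG)
    refine ⟨_, ⟨_, isAffinoidCover_pair (hb G hG) hH hun, subset_rfl⟩, G',
      mem_nhds_weakTree.2 ⟨{G'}, finite_singleton _, by simpa using hG', by simpa using hPG,
        by simp⟩, ?_⟩
    intro x y hx hxy
    -- Since x lies in G', hence not in H, the only member of the covering that can contain both x
    -- and y is G.
    simp only [coverEntourage, mem_iUnion, mem_insert_iff, mem_singleton_iff, exists_prop] at hxy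
    obtain ⟨Y, rfl | rfl, h1, h2⟩ := hxy
    · exact h2
    · exact absurd h1 (disjoint_left.1 hdis hx)
  choose! V hV U hU h using key
  refine ⟨⋂ G ∈ T, V G, (biInter_mem hT).2 hV, ⋂ G ∈ T, U G, (biInter_mem hT).2 hU, ?_⟩
  intro x y hx hxy
  refine hTW fun G hG => h G hG x y (mem_iInter₂.1 hx G hG) (mem_iInter₂.1 hxy G hG)

theorem absSub_lt_or_lt (a : K) {s t : ℝ≥0∞} (h : s < t) :
    {P : ArbP K | absSub a P < t} ∪ {P | s < absSub a P} = univ :=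
  eq_univ_of_forall fun Q => (lt_or_ge (absSub a Q) t).imp id h.trans_le

/-- The functions |T - a| are coordinates in [0,∞]^K, from which the weak topology inherits the
separation axioms. -/
theorem isInducing_absSub (hd : DenseValues K) :
    @IsInducing _ _ (weakTree K) _ (fun (P : ArbP K) (a : K) => absSub a P) := by
  let _ := weakTree K
  refine ⟨le_antisymm ?_ (le_generateFrom ?_)⟩
  · rw [← continuous_iff_le_induced]
    exact continuous_pi (continuous_weakTree_absSub hd)
  · rintro _ ⟨a, r, -, rfl | rfl⟩
    · exact ⟨{f | f a < ENNReal.ofReal r}, isOpen_lt (continuous_apply a) continuous_const, rfl⟩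
    · exact ⟨{f | ENNReal.ofReal r < f a}, isOpen_lt continuous_const (continuous_apply a), rfl⟩

theorem t2Space_weakTree (hd : DenseValues K) : @T2Space _ (weakTree K) := by
  let _ := weakTree K
  refine T2Space.of_injective_continuous ?_ (isInducing_absSub hd).continuous
  intro P Q h
  exact eq_of_absSub_eq fun a => congrFun h a

theorem regularSpace_weakTree (hd : DenseValues K) : @RegularSpace _ (weakTree K) :=
  let _ := weakTree K
  (isInducing_absSub hd).regularSpace

/-! ## Minimal Cauchy filters -/

/-- The filter on the projective line that is given by a point of the projective tree. -/
noncomputable def traceFilter (P : ArbP K) : Filter (P1 K) := comap classical (@nhds _ (weakTree K) P)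

theorem traceFilter_isCauchyFilter (hd : DenseValues K) (hg : GenericPoints K) (P : ArbP K) :
    IsCauchyFilter (traceFilter P) := by
  let _ := weakTree K
  refine ⟨?_, ?_⟩
  · rw [traceFilter, comap_neBot_iff_frequently, ← mem_closure_iff_frequently]
    exact denseRange_classical hd hg P
  · rintro V ⟨C, hC, hCV⟩
    obtain ⟨Y, hY, U, hU, hPU, rfl⟩ := hC.exists_mem_nhds hd hg P
    exact ⟨_, preimage_mem_comap (hU.mem_nhds hPU),
      (subset_biUnion_of_mem (u := fun Y : Set (P1 K) => Y ×ˢ Y) hY).trans hCV⟩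

/-- Take a member A that is small for the covering {G, H}. If one point of A lies outside G, pairing
it with each point of A forces A into H. -/
theorem IsCauchyFilter.mem_or_mem {F : Filter (P1 K)} (hF : IsCauchyFilter F)
    {G H : Set (ArbP K)} (hG : IsBasicOpen G) (hH : IsBasicOpen H) (h : G ∪ H = univ) :
    classical ⁻¹' G ∈ F ∨ classical ⁻¹' H ∈ F := by
  obtain ⟨A, hA, hAV⟩ := hF.2 _ ⟨_, isAffinoidCover_pair hG hH h, subset_rfl⟩
  by_cases hAG : A ⊆ classical ⁻¹' G
  · exact .inl (mem_of_superset hA hAG)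
  · obtain ⟨y, hy, hyG⟩ := not_subset.1 hAG
    refine .inr (mem_of_superset hA fun x hx => ?_)
    have := hAV (mk_mem_prod hx hy)
    simp only [coverEntourage, mem_iUnion, mem_insert_iff, mem_singleton_iff, exists_prop] at this
    obtain ⟨Y, rfl | rfl, h1, h2⟩ := this
    · exact absurd h2 hyG
    · exact h1

/-- A function on `K` that satisfies the ultrametric inequalities comes from a point of the
projective tree. -/
theorem exists_absSub_eq {ρ : K → ℝ≥0∞} (h1 : ∀ a b, ρ a ≤ max (ρ b) (edist b a))
    (h2 : ∀ a b, edist b a ≤ max (ρ b) (ρ a)) : ∃ P : ArbP K, ∀ a, absSub a P = ρ a := by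
  -- If ρ is infinite somewhere it is infinite everywhere, and the point is ∞.
  by_cases h0 : ρ 0 = ⊤
  · refine ⟨.infty, fun a => ?_⟩
    have := h1 0 a
    rw [h0, top_le_iff] at this
    rcases max_choice (ρ a) (edist a 0) with h | h <;> rw [h] at this
    · rw [this, absSub_infty]
    · exact absurd this (edist_ne_top _ _)
  have hfin : ∀ a, ρ a ≠ ⊤ := fun a =>
    ((h1 a 0).trans_lt (max_lt (lt_top_iff_ne_top.2 h0) (edist_lt_top _ _))).ne
  lift ρ to K → ℝ≥0 using hfin
  simp only [edist_nndist, ← ENNReal.coe_max, ENNReal.coe_le_coe] at h1 h2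
  have h1' : ∀ a b, (ρ a : ℝ) ≤ max (ρ b : ℝ) (dist b a) := fun a b => by exact_mod_cast h1 a b
  have h2' : ∀ a b, dist b a ≤ max (ρ b : ℝ) (ρ a) := fun a b => by exact_mod_cast h2 a b
  -- The infimum d plays the part of the diameter. The balls [c, ρ(c)] along a minimizing sequence
  -- of centres form a Cauchy sequence, as the second inequality makes their distances equal to half
  -- the differences of their radii.
  obtain ⟨u, -, hu, hmem⟩ := exists_seq_tendsto_sInf (S := range fun a => (ρ a : ℝ))
    (range_nonempty _) ⟨0, by rintro _ ⟨a, rfl⟩; exact (ρ a).coe_nonneg⟩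
  set d := sInf (range fun a => (ρ a : ℝ)) with hd
  choose c hc using hmem
  have hd' : ∀ a, d ≤ ρ a := fun a =>
    csInf_le ⟨0, by rintro _ ⟨a, rfl⟩; exact (ρ a).coe_nonneg⟩ ⟨a, rfl⟩
  have hcau : CauchySeq fun n => pt (c n) (ρ (c n)) := by
    rw [Metric.cauchySeq_iff]
    intro ε hε
    obtain ⟨N, hN⟩ := Metric.cauchySeq_iff.1 hu.cauchySeq ε hε
    refine ⟨N, fun m hm n hn => lt_of_le_of_lt ?_ (hN m hm n hn)⟩
    rw [dist_pt, max_eq_left (h2' _ _), ← hc, ← hc, Real.dist_eq]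
    rcases le_total (ρ (c m) : ℝ) (ρ (c n)) with h | h
    · rw [max_eq_right h, abs_of_nonpos (by linarith)]; linarith
    · rw [max_eq_left h, abs_of_nonneg (by linarith)]; linarith
  obtain ⟨S, hS⟩ := cauchySeq_tendsto_of_complete hcau
  refine ⟨.of S, fun a => ?_⟩
  have hlim := ((continuous_supr_left (pt a 0)).tendsto S).comp hS
  -- These suprema lie between ρ(a) and max {ρ(c n), ρ(a)}, which tends to max {d, ρ(a)} = ρ(a).
  have hlim' : Tendsto (fun n => max (ρ (c n) : ℝ) (dist (c n) a)) atTop (𝓝 (ρ a)) := by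
    have hu' : Tendsto (fun n => max (u n) (ρ a : ℝ)) atTop (𝓝 (ρ a)) := by
      have := hu.max (tendsto_const_nhds (x := (ρ a : ℝ)))
      rwa [max_eq_right (hd' a)] at this
    refine tendsto_of_tendsto_of_tendsto_of_le_of_le tendsto_const_nhds hu'
      (fun n => h1' _ _) (fun n => ?_)
    simp only [← hc]
    exact max_le (le_max_left _ _) (h2' _ _)
  have := tendsto_nhds_unique hlim (hlim'.congr fun n => (supr_pt_center _ _ _).symm)
  rw [absSub_of, this, ENNReal.ofReal_coe_nnreal]

/-- With ρ(a) the infimum of the radii of the open balls around a in F, balls of radius above ρ(a)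
belong to F. For c < r < ρ(a), the dichotomy for |T - a| < r and |T - a| > c puts the latter in F.
Hence F converges to the point given by ρ. -/
theorem IsCauchyFilter.exists_le_traceFilter (hd : DenseValues K) {F : Filter (P1 K)}
    (hF : IsCauchyFilter F) : ∃ P : ArbP K, F ≤ traceFilter P := by
  have := hF.1
  let ρ : K → ℝ≥0∞ := fun a => sInf {t | ∃ r ∈ valueGroup K, t = ENNReal.ofReal r ∧
    classical ⁻¹' {P | absSub a P < ENNReal.ofReal r} ∈ F}
  have p1 : ∀ a {c : ℝ≥0∞}, ρ a < c → classical ⁻¹' {P | absSub a P < c} ∈ F := by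
    intro a c h
    obtain ⟨_, ⟨r, hr, rfl, hrF⟩, hrc⟩ := sInf_lt_iff.1 h
    exact mem_of_superset hrF fun x hx => lt_trans hx hrc
  have p2 : ∀ a, ∀ c ∈ valueGroup K, ENNReal.ofReal c < ρ a →
      classical ⁻¹' {P | ENNReal.ofReal c < absSub a P} ∈ F := by
    intro a c hc h
    obtain ⟨r, hr, h1, h2⟩ := hd.exists_between h
    refine (hF.mem_or_mem ⟨a, r, hr, .inl rfl⟩ ⟨a, c, hc, .inr rfl⟩
      (absSub_lt_or_lt a h1)).resolve_left fun hmem => ?_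
    exact h2.not_ge (sInf_le ⟨r, hr, rfl, hmem⟩)
  obtain ⟨P, hP⟩ := exists_absSub_eq (ρ := ρ) (fun a b => by
    refine le_of_forall_gt fun t ht => ?_
    obtain ⟨r, hr, h1, h2⟩ := hd.exists_between ht
    refine lt_of_le_of_lt (sInf_le ⟨r, hr, rfl, ?_⟩) h2
    exact mem_of_superset (p1 b ((le_max_left _ _).trans_lt h1)) fun x hx =>
      (absSub_le_max a b _).trans_lt (max_lt hx ((le_max_right _ _).trans_lt h1))) (fun a b => by
    refine le_of_forall_gt fun t ht => ?_
    obtain ⟨x, hx, hx'⟩ := Filter.nonempty_of_mem (inter_mem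
      (p1 b ((le_max_left _ _).trans_lt ht)) (p1 a ((le_max_right _ _).trans_lt ht)))
    exact (edist_le_max_absSub a b _).trans_lt (max_lt hx hx'))
  refine ⟨P, ?_⟩
  rintro A ⟨U, hU, hUA⟩
  obtain ⟨T, hT, hb, hPT, hTU⟩ := mem_nhds_weakTree.1 hU
  refine mem_of_superset ?_ ((preimage_mono hTU).trans hUA)
  rw [preimage_sInter, biInter_mem hT]
  intro G hG
  have hPG := hPT G hG
  obtain ⟨a, r, hr, rfl | rfl⟩ := hb G hG
  · exact p1 a (by rwa [mem_ofPred_eq, hP] at hPG)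
  · exact p2 a r hr (by rwa [mem_ofPred_eq, hP] at hPG)

theorem eq_of_traceFilter_le (hd : DenseValues K) (hg : GenericPoints K) {P Q : ArbP K}
    (h : traceFilter P ≤ traceFilter Q) : P = Q := by
  let _ := weakTree K
  have := t2Space_weakTree hd
  have := (traceFilter_isCauchyFilter hd hg P).1
  have h1 : Tendsto classical (traceFilter P) (𝓝 P) := tendsto_comap
  have h2 : Tendsto classical (traceFilter P) (𝓝 Q) := tendsto_comap.mono_left h
  exact tendsto_nhds_unique h1 h2

/-- The canonical map from the projective tree to the Berkovich projective line. -/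
noncomputable def canonicalMap (hd : DenseValues K) (hg : GenericPoints K) (P : ArbP K) : Ber K :=
  ⟨traceFilter P, traceFilter_isCauchyFilter hd hg P, fun G hG hle => by
    -- Minimality: a coarser Cauchy filter G also converges to some Q, and Q = P by uniqueness of
    -- limits.
    obtain ⟨Q, hQ⟩ := hG.exists_le_traceFilter hd
    obtain rfl := eq_of_traceFilter_le hd hg (hle.trans hQ)
    exact le_antisymm hQ hle⟩

theorem canonicalMap_bijective (hd : DenseValues K) (hg : GenericPoints K) :
    Function.Bijective (canonicalMap hd hg) := by
  refine ⟨fun P Q h => eq_of_traceFilter_le hd hg (congrArg Subtype.val h).le, fun F => ?_⟩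
  obtain ⟨P, hP⟩ := F.2.1.exists_le_traceFilter hd
  exact ⟨P, Subtype.ext (F.2.2 _ (traceFilter_isCauchyFilter hd hg P) hP)⟩

/-! ## Transport of structure along a bijection -/

section Transport

variable {X Y : Type*} (τ : TopologicalSpace X) {f : X → Y}

/-- A bijection is a homeomorphism onto its target with the transported topology. -/
noncomputable def homeomorphCoinduced (hf : Function.Bijective f) :
    @Homeomorph X Y τ (TopologicalSpace.coinduced f τ) :=
  let _ := TopologicalSpace.coinduced f τ
  (Equiv.ofBijective f hf).toHomeomorph fun _ => isOpen_coinduced.symm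

theorem frontier_coinduced_image (hf : Function.Bijective f) (s : Set X) :
    @frontier Y (TopologicalSpace.coinduced f τ) (f '' s) = f '' @frontier X τ s :=
  let _ := TopologicalSpace.coinduced f τ
  ((homeomorphCoinduced τ hf).image_frontier s).symm

theorem closure_coinduced_image (hf : Function.Bijective f) (s : Set X) :
    @closure Y (TopologicalSpace.coinduced f τ) (f '' s) = f '' @closure X τ s :=
  let _ := TopologicalSpace.coinduced f τ
  ((homeomorphCoinduced τ hf).image_closure s).symm

theorem isConnected_coinduced_image {s : Set X} (hs : @IsConnected X τ s) :
    @IsConnected Y (TopologicalSpace.coinduced f τ) (f '' s) :=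
  let _ := TopologicalSpace.coinduced f τ
  hs.image f continuous_coinduced_rng.continuousOn

theorem t2Space_coinduced (hf : Function.Bijective f) (h : @T2Space X τ) :
    @T2Space Y (TopologicalSpace.coinduced f τ) :=
  let _ := TopologicalSpace.coinduced f τ
  (homeomorphCoinduced τ hf).t2Space

end Transport

/-! ## The weak topology of the Berkovich projective line -/

theorem mem_canonicalMap_iff (hd : DenseValues K) (hg : GenericPoints K) {P : ArbP K}
    {A : Set (P1 K)} : A ∈ (canonicalMap hd hg P).1 ↔
      ∃ U, IsOpen[weakTree K] U ∧ P ∈ U ∧ classical ⁻¹' U ⊆ A := by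
  let _ := weakTree K
  constructor
  · rintro ⟨U, hU, hUA⟩
    obtain ⟨W, hWU, hW, hPW⟩ := mem_nhds_iff.1 hU
    exact ⟨W, hW, hPW, (preimage_mono hWU).trans hUA⟩
  · rintro ⟨U, hU, hPU, hUA⟩
    exact ⟨U, hU.mem_nhds hPU, hUA⟩

/-- An open subset of the projective tree whose complement is the closure of its interior is
determined by its trace on the projective line. -/
theorem preimage_mem_canonicalMap_iff (hd : DenseValues K) (hg : GenericPoints K) {P : ArbP K}
    {Z : Set (ArbP K)} (hZ : IsOpen[weakTree K] Z)
    (hZ' : Zᶜ ⊆ @closure _ (weakTree K) (@interior _ (weakTree K) Zᶜ)) :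
    classical ⁻¹' Z ∈ (canonicalMap hd hg P).1 ↔ P ∈ Z := by
  let _ := weakTree K
  rw [mem_canonicalMap_iff]
  refine ⟨fun ⟨U, hU, hPU, hUZ⟩ => ?_, fun hP => ⟨Z, hZ, hP, subset_rfl⟩⟩
  by_contra hP
  -- If P were outside Z, then U would meet the interior of the complement in a nonempty open set,
  -- and so contain a classical point outside Z.
  obtain ⟨x, hx, hx'⟩ := (denseRange_classical hd hg).exists_mem_open (hU.inter isOpen_interior)
    (mem_closure_iff.1 (hZ' hP) U hU hPU)
  exact interior_subset hx' (hUZ hx)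

theorem preimage_mem_canonicalMap (hd : DenseValues K) (hg : GenericPoints K) {P : ArbP K}
    {Z : Set (ArbP K)} (hZ : IsOpen[weakTree K] Z) (hP : P ∈ Z) :
    classical ⁻¹' Z ∈ (canonicalMap hd hg P).1 :=
  (mem_canonicalMap_iff hd hg).2 ⟨Z, hZ, hP, subset_rfl⟩

/-- An entourage yields neighbourhoods in the tree because coverings extend to it. Conversely, a
neighbourhood in the tree contains one controlled by an entourage on classical points, and
regularity passes to all points. -/
theorem weakTopology_eq_coinduced (hd : DenseValues K) (hg : GenericPoints K) :
    weakTopology K = TopologicalSpace.coinduced (canonicalMap hd hg) (weakTree K) := by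
  refine TopologicalSpace.ext_iff.2 fun U => ?_
  let _ := weakTree K
  rw [isOpen_coinduced]
  refine Iff.trans ?_ isOpen_iff_mem_nhds.symm
  constructor
  · intro hU P hP
    obtain ⟨V, ⟨C, hC, hCV⟩, hV⟩ := hU _ hP
    obtain ⟨Y, hY, W, hW, hPW, rfl⟩ := hC.exists_mem_nhds hd hg P
    refine mem_of_superset (hW.mem_nhds hPW) fun Q hQ => hV _ ⟨classical ⁻¹' W,
      preimage_mem_canonicalMap hd hg hW hPW, preimage_mem_canonicalMap hd hg hW hQ, ?_⟩
    exact (subset_biUnion_of_mem (u := fun Y : Set (P1 K) => Y ×ˢ Y) hY).trans hCV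
  · intro hU F hF
    obtain ⟨P, rfl⟩ := (canonicalMap_bijective hd hg).2 F
    have hW := hU P hF
    have := regularSpace_weakTree hd
    -- A closed W is chosen because the entourage only places classical points in W; the point Q is
    -- a limit of such points.
    obtain ⟨W, hW, hWc, hWU⟩ := exists_mem_nhds_isClosed_subset hW
    obtain ⟨V, hV, N, hN, h⟩ := exists_entourage_subset hd hW
    refine ⟨V, hV, fun G ⟨A, hAF, hAG, hAV⟩ => ?_⟩
    obtain ⟨Q, rfl⟩ := (canonicalMap_bijective hd hg).2 G
    have := (traceFilter_isCauchyFilter hd hg P).1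
    have hAN : A ∩ classical ⁻¹' N ∈ traceFilter P := inter_mem hAF (preimage_mem_comap hN)
    obtain ⟨x, hxA, hxN⟩ := Filter.nonempty_of_mem hAN
    refine hWU (hWc.closure_eq ▸ mem_closure_iff_frequently.2 ?_)
    have hQ : Tendsto classical (traceFilter Q) (𝓝 Q) := tendsto_comap
    have := (traceFilter_isCauchyFilter hd hg Q).1
    refine hQ.frequently (Eventually.frequently ?_)
    exact mem_of_superset hAG fun y hy => h x y hxN (hAV (mk_mem_prod hxA hy))

/-! ## Frontiers and closures of the balls of the projective tree -/

section Frontier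

variable {τ : TopologicalSpace (ArbP K)} (hτ : fineTree K ≤ τ)
  (a : K) {r : ℝ≥0∞}

include hτ

theorem ray_mem_closure_lt (h0 : r ≠ 0) : ray a r ∈ @closure _ τ {P | absSub a P < r} := by
  have hc : @Continuous _ _ _ τ (ray a) := continuous_le_rng hτ (continuous_ray a)
  have hr : r ∈ closure (Iio r) := by
    rw [closure_Iio' ⟨0, pos_iff_ne_zero.2 h0⟩]; simp
  refine closure_mono ?_ (image_closure_subset_closure_image hc ⟨r, hr, rfl⟩)
  rintro _ ⟨t, ht, rfl⟩
  simpa using ht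

theorem ray_mem_closure_gt (htop : r ≠ ⊤) : ray a r ∈ @closure _ τ {P | r < absSub a P} := by
  have hc : @Continuous _ _ _ τ (ray a) := continuous_le_rng hτ (continuous_ray a)
  have hr : r ∈ closure (Ioi r) := by
    rw [closure_Ioi' ⟨⊤, htop.lt_top⟩]; simp
  refine closure_mono ?_ (image_closure_subset_closure_image hc ⟨r, hr, rfl⟩)
  rintro _ ⟨t, ht, rfl⟩
  simpa using ht

variable (hc : ∀ a : K, @Continuous _ _ τ _ (absSub a : ArbP K → ℝ≥0∞))

include hc

-- If P over r is off the ray from a, some b has |T - b| < r at P. On this neighbourhood of P the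
-- function |T - a| is constantly r, so the neighbourhood lies inside Z or misses it.
omit hτ in
theorem eq_ray_of_mem_frontier (htop : r ≠ ⊤) {Z : Set (ArbP K)}
    (hZ : Z = {P | absSub a P < r} ∨ Z = {P | absSub a P ≤ r}) {P : ArbP K}
    (hP : P ∈ @frontier _ τ Z) : absSub a P = r ∧ P = ray a r := by
  have hPr : absSub a P = r := by
    rcases hZ with rfl | rfl
    · exact frontier_lt_subset_eq (hc a) continuous_const hP
    · exact frontier_le_subset_eq (hc a) continuous_const hP
  refine ⟨hPr, ?_⟩
  subst hPr
  refine (ray_absSub_or_exists_lt htop).resolve_right ?_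
  rintro ⟨b, hb⟩
  have ho : IsOpen {Q : ArbP K | absSub b Q < absSub a P} := isOpen_lt (hc b) continuous_const
  have hn := ho.mem_nhds hb
  rcases hZ with rfl | rfl
  · obtain ⟨Q, hQ, hQ'⟩ := mem_closure_iff_nhds.1 hP.1 _ hn
    have hQ' : absSub a Q < absSub a P := hQ'
    exact hQ'.ne (absSub_eq_of_lt hb hQ)
  · refine hP.2 (mem_interior_iff_mem_nhds.2 (mem_of_superset hn fun Q hQ => ?_))
    exact (absSub_eq_of_lt hb hQ).le

theorem frontier_ball (h0 : r ≠ 0) (htop : r ≠ ⊤) {Z : Set (ArbP K)}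
    (hZ : Z = {P | absSub a P < r} ∨ Z = {P | absSub a P ≤ r}) :
    @frontier _ τ Z = {ray a r} := by
  refine Subset.antisymm (fun P hP => (eq_ray_of_mem_frontier a hc htop hZ hP).2) ?_
  rintro _ rfl
  rw [frontier_eq_closure_inter_closure]
  constructor
  · refine closure_mono ?_ (ray_mem_closure_lt hτ a h0)
    rcases hZ with rfl | rfl
    · exact subset_rfl
    · exact fun P (hP : absSub a P < r) => hP.le
  · refine closure_mono ?_ (ray_mem_closure_gt hτ a htop)
    rcases hZ with rfl | rfl
    · exact fun P (hP : r < absSub a P) => not_lt.2 hP.le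
    · exact fun P (hP : r < absSub a P) => not_le.2 hP

theorem frontier_absSub_preimage (h0 : r ≠ 0) (htop : r ≠ ⊤) {I : Set ℝ≥0∞}
    (hI : I = Iio r ∨ I = Iic r ∨ I = Ioi r ∨ I = Ici r) :
    @frontier _ τ (absSub a ⁻¹' I) = {ray a r} := by
  rcases hI with rfl | rfl | rfl | rfl
  · exact frontier_ball hτ a hc h0 htop (.inl rfl)
  · exact frontier_ball hτ a hc h0 htop (.inr rfl)
  · rw [← compl_Iic, preimage_compl, frontier_compl]
    exact frontier_ball hτ a hc h0 htop (.inr rfl)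
  · rw [← compl_Iio, preimage_compl, frontier_compl]
    exact frontier_ball hτ a hc h0 htop (.inl rfl)

/-- The only point that is not interior is the frontier point [a,r], and it is a limit of interior
points along the ray. This regularity lets the trace on the projective line recover the ball. -/
theorem subset_closure_interior (h0 : r ≠ 0) (htop : r ≠ ⊤) {I : Set ℝ≥0∞}
    (hI : I = Iic r ∨ I = Ici r) :
    (absSub a ⁻¹' I : Set (ArbP K)) ⊆ @closure _ τ (@interior _ τ (absSub a ⁻¹' I)) := by
  intro P hP
  by_cases hPi : P ∈ @interior _ τ (absSub a ⁻¹' I)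
  · exact subset_closure hPi
  · have hfr : P ∈ @frontier _ τ (absSub a ⁻¹' I) := ⟨subset_closure hP, hPi⟩
    rw [frontier_absSub_preimage hτ a hc h0 htop (by tauto), mem_singleton_iff] at hfr
    subst hfr
    rcases hI with rfl | rfl
    · refine closure_mono (interior_maximal ?_ ?_) (ray_mem_closure_lt hτ a h0)
      · exact fun P (hP : absSub a P < r) => hP.le
      · exact isOpen_lt (hc a) continuous_const
    · refine closure_mono (interior_maximal ?_ ?_) (ray_mem_closure_gt hτ a htop)
      · exact fun P (hP : r < absSub a P) => hP.le
      · exact isOpen_lt continuous_const (hc a)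

end Frontier

/-! ## Balls of the Berkovich projective line -/

section Balls

variable (hd : DenseValues K) (hg : GenericPoints K)

theorem hat_preimage (a : K) {r : ℝ≥0∞} (h0 : r ≠ 0) (htop : r ≠ ⊤) {I : Set ℝ≥0∞}
    (hI : I = Iio r ∨ I = Ioi r) :
    hat (classical ⁻¹' (absSub a ⁻¹' I)) = canonicalMap hd hg '' (absSub a ⁻¹' I) := by
  have hc := continuous_weakTree_absSub hd
  have key : ∀ P : ArbP K, classical ⁻¹' (absSub a ⁻¹' I) ∈ (canonicalMap hd hg P).1 ↔
      P ∈ absSub a ⁻¹' I := by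
    intro P
    have hopen : IsOpen[weakTree K] (absSub a ⁻¹' I) := by
      rcases hI with rfl | rfl
      exacts [@IsOpen.preimage _ _ (weakTree K) _ _ (hc a) _ isOpen_Iio,
        @IsOpen.preimage _ _ (weakTree K) _ _ (hc a) _ isOpen_Ioi]
    refine preimage_mem_canonicalMap_iff hd hg hopen ?_
    rw [← preimage_compl]
    refine subset_closure_interior fineTree_le_weakTree a hc h0 htop ?_
    rcases hI with rfl | rfl
    · exact .inr compl_Iio
    · exact .inl compl_Ioi
  ext F
  obtain ⟨P, rfl⟩ := (canonicalMap_bijective hd hg).2 F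
  rw [(canonicalMap_bijective hd hg).1.mem_set_image]
  exact key P

theorem preimage_lt_mem_canonicalMap (a : K) {r : ℝ} (hr : 0 < r) (P : ArbP K) :
    toP1 {z | ‖z - a‖ < r} ∈ (canonicalMap hd hg P).1 ↔ absSub a P < ENNReal.ofReal r := by
  rw [toP1_lt a hr]
  have := hat_preimage hd hg a (r := ENNReal.ofReal r) (by simpa using hr) ENNReal.ofReal_ne_top
    (.inl rfl)
  have h2 : canonicalMap hd hg P ∈ hat (classical ⁻¹' (absSub a ⁻¹' Iio (ENNReal.ofReal r))) ↔
    P ∈ absSub a ⁻¹' Iio (ENNReal.ofReal r) := by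
    rw [this, (canonicalMap_bijective hd hg).1.mem_set_image]
  exact h2

/-! ### Classical points and closures of balls -/

theorem isClassicalPoint_canonicalMap (x : P1 K) :
    IsClassicalPoint (canonicalMap hd hg (classical x)) x := by
  intro A
  let _ := weakTree K
  constructor
  · rintro ⟨W, hW, hWA⟩
    obtain ⟨V, hV, U, hU, h⟩ := exists_entourage_subset hd hW
    exact ⟨V, hV, fun y hy => hWA (h x y (mem_of_mem_nhds hU) hy)⟩
  · rintro ⟨V, ⟨C, hC, hCV⟩, hVA⟩
    obtain ⟨Y, hY, U, hU, hxU, rfl⟩ := hC.exists_mem_nhds hd hg (classical x)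
    refine mem_of_superset (preimage_mem_canonicalMap hd hg hU hxU) fun y hy => hVA (hCV ?_)
    exact mem_biUnion hY (mk_mem_prod hxU hy)

theorem isClassicalPoint_iff {F : Ber K} {x : P1 K} :
    IsClassicalPoint F x ↔ F = canonicalMap hd hg (classical x) := by
  refine ⟨fun h => Subtype.ext (Filter.ext fun A => ?_), fun h => h ▸ ?_⟩
  · rw [h A, ← isClassicalPoint_canonicalMap hd hg x A]
  · exact isClassicalPoint_canonicalMap hd hg x

theorem classicalImage_eq (Y : Set (P1 K)) :
    classicalImage Y = canonicalMap hd hg '' (classical '' Y) := by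
  ext F
  simp only [classicalImage, mem_ofPred_eq, isClassicalPoint_iff hd hg, mem_image,
    exists_exists_and_eq_and, eq_comm (a := F)]

theorem bar_preimage (a : K) {r : ℝ≥0∞} (h0 : r ≠ 0) (htop : r ≠ ⊤) {I : Set ℝ≥0∞}
    (hI : I = Iic r ∨ I = Ici r) :
    bar (classical ⁻¹' (absSub a ⁻¹' I)) = canonicalMap hd hg '' (absSub a ⁻¹' I) := by
  have hc := continuous_weakTree_absSub hd
  rw [bar, classicalImage_eq hd hg, weakTopology_eq_coinduced hd hg,
    closure_coinduced_image _ (canonicalMap_bijective hd hg)]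
  congr 1
  let _ := weakTree K
  have hcl : IsClosed (absSub a ⁻¹' I : Set (ArbP K)) := by
    refine IsClosed.preimage (hc a) ?_
    rcases hI with rfl | rfl
    exacts [isClosed_Iic, isClosed_Ici]
  refine Subset.antisymm (closure_minimal (image_preimage_subset _ _) hcl) ?_
  -- The preimage of I is the closure of its interior, in which the classical points are dense.
  refine (subset_closure_interior fineTree_le_weakTree a hc h0 htop hI).trans ?_
  refine closure_minimal ?_ isClosed_closure
  refine ((denseRange_classical hd hg).open_subset_closure_inter isOpen_interior).trans
    (closure_mono ?_)
  rintro _ ⟨hP, x, rfl⟩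
  exact ⟨x, interior_subset (s := absSub a ⁻¹' I) hP, rfl⟩

/-! ## The ball attached to a point -/

omit [IsUltrametricDist K] in
theorem lt_eq_le_of_notMem_valueGroup (a : K) {r : ℝ} (hr : 0 < r) (h : r ∉ valueGroup K) :
    {z : K | ‖z - a‖ < r} = {z | ‖z - a‖ ≤ r} := by
  ext z
  rw [mem_ofPred_eq, mem_ofPred_eq]
  refine ⟨le_of_lt, fun hz => lt_of_le_of_ne hz fun he => h ⟨z - a, ?_, he⟩⟩
  rintro h0
  rw [h0, norm_zero] at he
  exact hr.ne he

omit [IsUltrametricDist K] in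
theorem isClosedBallK_or_isIrrationalBallK (a : K) {r : ℝ} (hr : 0 < r) :
    IsClosedBallK {z : K | ‖z - a‖ ≤ r} ∨ IsIrrationalBallK {z : K | ‖z - a‖ ≤ r} := by
  by_cases h : r ∈ valueGroup K
  · exact .inl ⟨a, r, h, rfl⟩
  · exact .inr ⟨a, r, hr, h, (lt_eq_le_of_notMem_valueGroup a hr h).symm⟩

omit [IsUltrametricDist K] in
theorem exists_of_isClosedBallK_or_isIrrationalBallK {D : Set K}
    (h : IsClosedBallK D ∨ IsIrrationalBallK D) :
    ∃ (a : K) (r : ℝ), 0 < r ∧ D = {z | ‖z - a‖ ≤ r} := by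
  rcases h with ⟨a, r, hr, rfl⟩ | ⟨a, r, hr, h, rfl⟩
  · exact ⟨a, r, valueGroup_pos hr, rfl⟩
  · exact ⟨a, r, hr, lt_eq_le_of_notMem_valueGroup a hr h⟩

-- The diameter need not be attained on an open ball; points a + y with |y| in |K^*| just below r
-- show that it is not smaller than r.
include hd in
theorem metric_diam_ball (a : K) {r : ℝ} (hr : 0 < r) {E : Set K}
    (hE : E = {z | ‖z - a‖ < r} ∨ E = {z | ‖z - a‖ ≤ r}) : Metric.diam E = r := by
  have h1 : {z | ‖z - a‖ < r} ⊆ E := by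
    rcases hE with rfl | rfl
    exacts [subset_rfl, fun z (hz : ‖z - a‖ < r) => hz.le]
  have h2 : E ⊆ {z | ‖z - a‖ ≤ r} := by
    rcases hE with rfl | rfl
    exacts [fun z (hz : ‖z - a‖ < r) => hz.le, subset_rfl]
  have hdist : ∀ x ∈ E, ∀ y ∈ E, dist x y ≤ r := by
    intro x hx y hy
    refine (dist_triangle_max x a y).trans (max_le ?_ ?_)
    · rw [dist_eq_norm]; exact h2 hx
    · rw [dist_comm, dist_eq_norm]; exact h2 hy
  refine le_antisymm (Metric.diam_le_of_forall_dist_le hr.le hdist) ?_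
  refine le_of_forall_lt fun c hcr => ?_
  obtain ⟨_, ⟨y, hy, rfl⟩, hv1, hv2⟩ := hd (max 0 c) r (le_max_left _ _) (max_lt hr hcr)
  have hm := Metric.dist_le_diam_of_mem (Metric.isBounded_iff.2 ⟨r, fun x hx y hy =>
    hdist x hx y hy⟩) (h1 (a := a + y) (by simpa using hv2)) (h1 (a := a) (by simpa using hr))
  rw [dist_eq_norm, add_sub_cancel_left] at hm
  exact ((le_max_right _ _).trans_lt hv1).trans_le hm

include hd in
omit [IsUltrametricDist K] in
theorem closedBall_radius_le {x : K} {s t : ℝ} (hs : 0 ≤ t)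
    (h : {z : K | ‖z - x‖ ≤ s} ⊆ {z | ‖z - x‖ ≤ t}) : s ≤ t := by
  by_contra! hlt
  obtain ⟨_, ⟨y, hy, rfl⟩, h1, h2⟩ := hd t s hs hlt
  have := h (a := x + y) (by simpa using h2.le)
  rw [mem_ofPred_eq, add_sub_cancel_left] at this
  exact this.not_gt h1

theorem closedBall_eq_of_mem {a b : K} {r : ℝ} (h : ‖a - b‖ ≤ r) :
    {z : K | ‖z - b‖ ≤ r} = {z | ‖z - a‖ ≤ r} := by
  ext z
  simp only [mem_ofPred_eq, ← dist_eq_norm] at h ⊢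
  constructor
  · exact fun hz => (dist_triangle_max z b a).trans (max_le hz (by rwa [dist_comm]))
  · exact fun hz => (dist_triangle_max z a b).trans (max_le hz h)

omit [NormedField K] [IsUltrametricDist K] in
theorem toP1_injective : Function.Injective (toP1 : Set K → Set (P1 K)) :=
  image_injective.2 (OnePoint.coe_injective)

omit [NormedField K] [IsUltrametricDist K] in
theorem infty_notMem_toP1 (D : Set K) : (OnePoint.infty : P1 K) ∉ toP1 D := by
  rintro ⟨z, -, h⟩
  exact OnePoint.coe_ne_infty z h

omit [NormedField K] [IsUltrametricDist K] in
theorem toP1_ne_compl_toP1 (D E : Set K) : toP1 D ≠ (toP1 E)ᶜ := fun h =>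
  infty_notMem_toP1 D (h ▸ infty_notMem_toP1 E)

-- The set E is determined by B, since E omits ∞. The diameter then fixes the radius of D, and the
-- inclusion of E in D allows a as its centre.
include hd in
theorem isPointOfBall_iff (a : K) {r : ℝ} (hr : 0 < r) {E : Set K}
    (hE : E = {z | ‖z - a‖ < r} ∨ E = {z | ‖z - a‖ ≤ r}) {B : Set (P1 K)}
    (hB : B = toP1 E ∨ B = (toP1 E)ᶜ) {F : Ber K} :
    IsPointOfBall F B ↔ core F = toP1 {z | ‖z - a‖ ≤ r} := by
  constructor
  · rintro ⟨D, E', hB', hD, hED, hdiam, hcore⟩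
    obtain rfl : E = E' := by
      apply toP1_injective
      rcases hB with rfl | rfl <;> rcases hB' with h | h
      · exact h
      · exact absurd h (toP1_ne_compl_toP1 _ _)
      · exact absurd h.symm (toP1_ne_compl_toP1 _ _)
      · exact compl_injective h
    obtain ⟨b, s, hs, rfl⟩ := exists_of_isClosedBallK_or_isIrrationalBallK hD
    rw [metric_diam_ball hd b hs (.inr rfl), metric_diam_ball hd a hr hE] at hdiam
    subst hdiam
    have ha : a ∈ E := by rcases hE with rfl | rfl <;> simp [hr, hr.le]
    rw [hcore, closedBall_eq_of_mem (hED ha)]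
  · intro h
    refine ⟨_, E, hB, isClosedBallK_or_isIrrationalBallK a hr, ?_, ?_, h⟩
    · rcases hE with rfl | rfl
      exacts [fun z (hz : ‖z - a‖ < r) => hz.le, subset_rfl]
    · rw [metric_diam_ball hd a hr (.inr rfl), metric_diam_ball hd a hr hE]

theorem absSub_le_of_toP1_mem (a : K) {r : ℝ} {P : ArbP K}
    (h : toP1 {z | ‖z - a‖ ≤ r} ∈ (canonicalMap hd hg P).1) : absSub a P ≤ ENNReal.ofReal r := by
  refine le_of_forall_gt fun t ht => ?_
  obtain ⟨c, hc, h1, h2⟩ := hd.exists_between ht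
  rw [ENNReal.ofReal_lt_ofReal_iff (valueGroup_pos hc)] at h1
  refine lt_trans ((preimage_lt_mem_canonicalMap hd hg a (valueGroup_pos hc) P).1 ?_) h2
  exact mem_of_superset h (image_mono fun z hz => lt_of_le_of_lt hz h1)

theorem core_canonicalMap_pt (x : K) (r : ℝ≥0) :
    core (canonicalMap hd hg (.of (pt x r))) = toP1 {z | ‖z - x‖ ≤ r} := by
  refine Subset.antisymm (fun w hw => ?_) ?_
  -- The open balls around x of radius c > r in |K^*| belong to the filter, and their intersection
  -- is already the closed ball.
  · have hmem : ∀ c ∈ valueGroup K, (r : ℝ) < c → w ∈ toP1 {z | ‖z - x‖ < c} := by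
      intro c hc hrc
      refine hw _ ⟨?_, _, .inl ⟨x, c, hc, rfl⟩, rfl⟩
      rw [preimage_lt_mem_canonicalMap hd hg x (valueGroup_pos hc), absSub_pt, edist_self,
        max_eq_left zero_le, ← ENNReal.ofReal_coe_nnreal,
        ENNReal.ofReal_lt_ofReal_iff (valueGroup_pos hc)]
      exact hrc
    obtain ⟨c, hc, hrc, -⟩ := hd r (r + 1) r.coe_nonneg (by linarith)
    obtain ⟨z, -, rfl⟩ := hmem c hc hrc
    refine ⟨z, ?_, rfl⟩
    by_contra hlt
    obtain ⟨c, hc, h1, h2⟩ := hd r _ r.coe_nonneg (not_le.1 hlt)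
    obtain ⟨z', hz', he⟩ := hmem c hc h1
    obtain rfl := OnePoint.coe_injective he
    exact lt_asymm h2 hz'
  · rintro _ ⟨z, hz, rfl⟩ _ ⟨hA, D, hD, rfl⟩
    refine ⟨z, ?_, rfl⟩
    -- A point z of the ball [x,r] has |z - a| at most the value of |T - a| at [x,r], so it lies in
    -- every ball of K that belongs to the filter.
    have hz' : ∀ a, edist z a ≤ absSub a (.of (pt x r)) := by
      intro a
      rw [absSub_pt, ← absSub_classical_coe]
      refine (absSub_le_max a x _).trans (max_le_max ?_ le_rfl)
      rw [absSub_classical_coe, edist_dist, ← ENNReal.ofReal_coe_nnreal, dist_eq_norm]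
      exact ENNReal.ofReal_le_ofReal hz
    have hlt : ∀ a c, 0 < c → toP1 {z | ‖z - a‖ < c} ∈ (canonicalMap hd hg (.of (pt x r))).1 →
        ‖z - a‖ < c := by
      intro a c hc h
      have := (hz' a).trans_lt ((preimage_lt_mem_canonicalMap hd hg a hc _).1 h)
      rwa [edist_dist, dist_eq_norm, ENNReal.ofReal_lt_ofReal_iff hc] at this
    rcases hD with ⟨a, c, hc, rfl⟩ | ⟨a, c, hc, rfl⟩ | ⟨a, c, hc, -, rfl⟩
    · exact hlt a c (valueGroup_pos hc) hA
    · have := (hz' a).trans (absSub_le_of_toP1_mem hd hg a hA)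
      rwa [edist_dist, dist_eq_norm, ENNReal.ofReal_le_ofReal_iff (valueGroup_pos hc).le] at this
    · exact hlt a c hc hA

/-- As x lies in every ball of K belonging to the filter, |x - b| is at most the value of |T - b| at
S for all b. Hence no centre is closer to S than x, which forces S = [x, diam S]; density of |K^*|
then recovers the radius from the ball. -/
theorem eq_pt_of_core_eq {P : ArbP K} {x : K} {r : ℝ≥0}
    (h : core (canonicalMap hd hg P) = toP1 {z | ‖z - x‖ ≤ r}) : P = .of (pt x r) := by
  rcases P with S | _
  · have hx : (x : P1 K) ∈ core (canonicalMap hd hg (.of S)) := by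
      rw [h]; exact ⟨x, by simp, rfl⟩
    have hxb : ∀ b, edist x b ≤ absSub b (.of S) := by
      intro b
      refine le_of_forall_gt fun t ht => ?_
      obtain ⟨c, hc, h1, h2⟩ := hd.exists_between ht
      obtain ⟨z, hz, he⟩ := hx _ ⟨(preimage_lt_mem_canonicalMap hd hg b (valueGroup_pos hc) _).2 h1,
        _, .inl ⟨b, c, hc, rfl⟩, rfl⟩
      obtain rfl := OnePoint.coe_injective he
      refine lt_trans ?_ h2
      rw [edist_dist, dist_eq_norm, ENNReal.ofReal_lt_ofReal_iff (valueGroup_pos hc)]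
      exact hz
    have hS : S = pt x (diam S).toNNReal := by
      refine eq_pt_of_supr_le_diam (Real.coe_toNNReal _ (diam_nonneg _)).symm ?_
      by_contra hlt
      obtain ⟨b, hb⟩ := exists_supr_lt (not_le.1 hlt)
      have h1 := absSub_le_max x b (.of S)
      rw [edist_comm, max_eq_left (hxb b), absSub_of, absSub_of,
        ENNReal.ofReal_le_ofReal_iff (supr_nonneg _ _)] at h1
      exact hb.not_ge h1
    rw [hS, core_canonicalMap_pt] at h
    have h' := toP1_injective h
    have he : (diam S).toNNReal = r := NNReal.coe_injective
      (le_antisymm (closedBall_radius_le hd r.coe_nonneg h'.subset)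
        (closedBall_radius_le hd (NNReal.coe_nonneg _) h'.symm.subset))
    rw [hS, he]
  -- At ∞ no ball of K belongs to the filter, so the intersection is empty-indexed and contains ∞.
  · refine absurd ?_ (infty_notMem_toP1 {z : K | ‖z - x‖ ≤ r})
    rw [← h]
    rintro _ ⟨hA, D, hD, rfl⟩
    exfalso
    rcases hD with ⟨a, c, hc, rfl⟩ | ⟨a, c, hc, rfl⟩ | ⟨a, c, hc, -, rfl⟩
    · simpa using (preimage_lt_mem_canonicalMap hd hg a (valueGroup_pos hc) _).1 hA
    · simpa using absSub_le_of_toP1_mem hd hg a hA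
    · simpa using (preimage_lt_mem_canonicalMap hd hg a hc _).1 hA

/-! ## The canonical map -/

theorem isCanonicalMap_canonicalMap : IsCanonicalMap (canonicalMap hd hg) where
  continuous := by
    rw [weakTopology_eq_coinduced hd hg, continuous_iff_coinduced_le]
    exact coinduced_mono fineTree_le_weakTree
  core_eq x r _ := core_canonicalMap_pt hd hg x r

/-- The two maps are continuous into a Hausdorff space and agree on the dense set of balls of
positive radius, where the core determines the point. -/
theorem IsCanonicalMap.eq_canonicalMap {ι : ArbP K → Ber K} (h : IsCanonicalMap ι) :
    ι = canonicalMap hd hg := by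
  let _ := weakTopology K
  have : T2Space (Ber K) := by
    have := t2Space_coinduced _ (canonicalMap_bijective hd hg) (t2Space_weakTree hd)
    rwa [← weakTopology_eq_coinduced hd hg] at this
  refine Continuous.ext_on dense_pt_pos h.continuous (isCanonicalMap_canonicalMap hd hg).continuous
    ?_
  rintro _ ⟨x, r, hr, rfl⟩
  obtain ⟨Q, hQ⟩ := (canonicalMap_bijective hd hg).2 (ι (.of (pt x r)))
  rw [← hQ, eq_pt_of_core_eq hd hg (P := Q) (by rw [hQ, h.core_eq x r hr])]

/-- A ball of the Berkovich projective line is the image of a ball of the projective tree. -/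
theorem IsBerBall.exists_eq_image {B : Set (P1 K)} {𝔅 : Set (Ber K)} (h : IsBerBall B 𝔅) :
    ∃ (a : K) (r : ℝ) (E : Set K) (I : Set ℝ≥0∞), 0 < r ∧
      (E = {z | ‖z - a‖ < r} ∨ E = {z | ‖z - a‖ ≤ r}) ∧ (B = toP1 E ∨ B = (toP1 E)ᶜ) ∧
      (I = Iio (ENNReal.ofReal r) ∨ I = Iic (ENNReal.ofReal r) ∨ I = Ioi (ENNReal.ofReal r) ∨
        I = Ici (ENNReal.ofReal r)) ∧
      𝔅 = canonicalMap hd hg '' (absSub a ⁻¹' I) := by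
  have hhat : ∀ (a : K) {r : ℝ} {I : Set ℝ≥0∞}, 0 < r → I = Iio (ENNReal.ofReal r) ∨
      I = Ioi (ENNReal.ofReal r) →
      hat (classical ⁻¹' (absSub a ⁻¹' I)) = canonicalMap hd hg '' (absSub a ⁻¹' I) :=
    fun a r I hr => hat_preimage hd hg a (by simpa using hr) ENNReal.ofReal_ne_top
  have hbar : ∀ (a : K) {r : ℝ} {I : Set ℝ≥0∞}, 0 < r → I = Iic (ENNReal.ofReal r) ∨
      I = Ici (ENNReal.ofReal r) →
      bar (classical ⁻¹' (absSub a ⁻¹' I)) = canonicalMap hd hg '' (absSub a ⁻¹' I) :=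
    fun a r I hr => bar_preimage hd hg a (by simpa using hr) ENNReal.ofReal_ne_top
  have hlt : ∀ (a : K) {r : ℝ}, 0 < r →
      toP1 {z | ‖z - a‖ < r} = classical ⁻¹' (absSub a ⁻¹' Iio (ENNReal.ofReal r)) :=
    fun a r hr => toP1_lt a hr
  have hle : ∀ (a : K) {r : ℝ}, 0 < r →
      toP1 {z | ‖z - a‖ ≤ r} = classical ⁻¹' (absSub a ⁻¹' Iic (ENNReal.ofReal r)) :=
    fun a r hr => toP1_le a hr
  have hgt : ∀ (a : K) {r : ℝ}, 0 < r →
      (toP1 {z | ‖z - a‖ ≤ r})ᶜ = classical ⁻¹' (absSub a ⁻¹' Ioi (ENNReal.ofReal r)) :=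
    fun a r hr => compl_toP1_le a hr
  have hge : ∀ (a : K) {r : ℝ}, 0 < r →
      (toP1 {z | ‖z - a‖ < r})ᶜ = classical ⁻¹' (absSub a ⁻¹' Ici (ENNReal.ofReal r)) :=
    fun a r hr => compl_toP1_lt a hr
  rcases h with ⟨⟨D, ⟨⟨a, r, hr, rfl⟩, rfl⟩ | ⟨⟨a, r, hr, rfl⟩, rfl⟩⟩ |
    ⟨D, ⟨a, r, hr, hirr, rfl⟩, rfl | rfl⟩, rfl⟩ | ⟨⟨D, ⟨⟨a, r, hr, rfl⟩, rfl⟩ |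
    ⟨⟨a, r, hr, rfl⟩, rfl⟩⟩ | ⟨D, ⟨a, r, hr, hirr, rfl⟩, rfl | rfl⟩, rfl⟩
  · have hr := valueGroup_pos hr
    exact ⟨a, r, _, _, hr, .inl rfl, .inl rfl, .inl rfl, by
      rw [hlt a hr, hhat a hr (.inl rfl)]⟩
  · have hr := valueGroup_pos hr
    exact ⟨a, r, _, _, hr, .inr rfl, .inr rfl, .inr (.inr (.inl rfl)), by
      rw [hgt a hr, hhat a hr (.inr rfl)]⟩
  · exact ⟨a, r, _, _, hr, .inl rfl, .inl rfl, .inl rfl, by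
      rw [hlt a hr, hhat a hr (.inl rfl)]⟩
  · exact ⟨a, r, _, _, hr, .inl rfl, .inr rfl, .inr (.inr (.inl rfl)), by
      rw [lt_eq_le_of_notMem_valueGroup a hr hirr, hgt a hr, hhat a hr (.inr rfl)]⟩
  · have hr := valueGroup_pos hr
    exact ⟨a, r, _, _, hr, .inr rfl, .inl rfl, .inr (.inl rfl), by
      rw [hle a hr, hbar a hr (.inl rfl)]⟩
  · have hr := valueGroup_pos hr
    exact ⟨a, r, _, _, hr, .inl rfl, .inr rfl, .inr (.inr (.inr rfl)), by
      rw [hge a hr, hbar a hr (.inr rfl)]⟩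
  · exact ⟨a, r, _, _, hr, .inl rfl, .inl rfl, .inr (.inl rfl), by
      rw [lt_eq_le_of_notMem_valueGroup a hr hirr, hle a hr, hbar a hr (.inl rfl)]⟩
  · exact ⟨a, r, _, _, hr, .inl rfl, .inr rfl, .inr (.inr (.inr rfl)), by
      rw [hge a hr, hbar a hr (.inr rfl)]⟩

end Balls

end BerkovichLine

open BerkovichLine
theorem mainTheorem11 (K : Type*) [NormedField K] [IsUltrametricDist K] [CompleteSpace K]
    (hres : Infinite (IsLocalRing.ResidueField (NormedField.valuation (K := K)).valuationSubring))
    (hval : ¬ DiscreteTopology (valueGroup K)) :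
    ∃ ι : ArbP K → Ber K,
      IsCanonicalMap ι ∧ (∀ ι' : ArbP K → Ber K, IsCanonicalMap ι' → ι' = ι) ∧
      Function.Bijective ι ∧
      ∀ (B : Set (P1 K)) (𝔅 : Set (Ber K)), IsBerBall B 𝔅 →
        @IsConnected _ (weakTopology K) 𝔅 ∧
        @IsConnected _ (fineTopology ι) 𝔅 ∧
        ∃ F : Ber K, (∀ G : Ber K, IsPointOfBall G B ↔ G = F) ∧
          @frontier _ (weakTopology K) 𝔅 = {F} ∧
          @frontier _ (fineTopology ι) 𝔅 = {F} := by
  have hd := denseValues_of_not_discreteTopology hval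
  have hg := genericPoints_of_infinite_residueField hres
  have hbij := canonicalMap_bijective hd hg
  refine ⟨canonicalMap hd hg, isCanonicalMap_canonicalMap hd hg,
    fun ι' h => h.eq_canonicalMap hd hg, hbij, fun B 𝔅 hB => ?_⟩
  obtain ⟨a, r, E, I, hr, hE, hBE, hI, rfl⟩ := hB.exists_eq_image hd hg
  have h0 : ENNReal.ofReal r ≠ 0 := by simpa using hr
  have hI' : I.OrdConnected ∧ I.Nonempty := by
    rcases hI with rfl | rfl | rfl | rfl
    · exact ⟨ordConnected_Iio, 0, pos_iff_ne_zero.2 h0⟩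
    · exact ⟨ordConnected_Iic, nonempty_Iic⟩
    · exact ⟨ordConnected_Ioi, ⊤, ENNReal.ofReal_lt_top⟩
    · exact ⟨ordConnected_Ici, nonempty_Ici⟩
  have hconn := isConnected_absSub_preimage a hI'.1 hI'.2
  have hmap := (isCanonicalMap_canonicalMap hd hg).continuous
  refine ⟨?_, isConnected_coinduced_image _ hconn, canonicalMap hd hg (ray a (ENNReal.ofReal r)), ?_, ?_, ?_⟩
  -- Connectedness for the weak topology follows from the chordal one, as the canonical map is
  -- continuous between them.
  · let _ := weakTopology K
    exact hconn.image _ hmap.continuousOn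
  · intro G
    lift r to ℝ≥0 using hr.le
    rw [isPointOfBall_iff hd a hr hE hBE, ENNReal.ofReal_coe_nnreal, ray_coe]
    obtain ⟨P, rfl⟩ := hbij.2 G
    constructor
    · intro h
      rw [eq_pt_of_core_eq hd hg h]
    · rintro h
      rw [h, core_canonicalMap_pt]
  · rw [weakTopology_eq_coinduced hd hg, frontier_coinduced_image _ hbij,
      frontier_absSub_preimage fineTree_le_weakTree a (continuous_weakTree_absSub hd) h0
        ENNReal.ofReal_ne_top hI, image_singleton]
  · rw [fineTopology, frontier_coinduced_image _ hbij,
      frontier_absSub_preimage le_rfl a continuous_absSub h0 ENNReal.ofReal_ne_top hI,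
      image_singleton]
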